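/- Let $q\in(0,1)$ and let $\mathbb N=\{0,1,2,\dots\}$. Let $\mathcal K$ be the compact operators on $\ell_2(\mathbb N)$, with standard orthonormal basis $(e_n)_{n\ge 0}$; let $S$ be the unilateral shift, $Se_n=e_{n+1}$; and let $\mathcal T\subseteq B(\ell_2(\mathbb N))$ be the Toeplitz algebra, i.e. the unital $C^*$-algebra generated by $S$. Let $u\in C(S^1)$ be $u(z)=z$, and let $\sigma:\mathcal T\to C(S^1)$ be the symbol map, the $*$-homomorphism with $\sigma(S)=u$. Let $C(S_q^2)$ be the $C^*$-algebra of the standard Podleś sphere, i.e. the universal unital $C^*$-algebra generated by elements $A=A^*$ and $B$ with $$BA=q^2AB,\qquad B^*B=A-A^2,\qquad BB^*=q^2A-q^4A^2 .$$ It is realized as $\mathcal K\oplus\mathbb C=\{k+\alpha 1 : k\in\mathcal K,\ \alpha\in\mathbb C\}\subseteq B(\ell_2(\mathbb N))$ with generators $Ae_n=q^{2n}e_n$, $Be_n=q^n(1-q^{2n})^{1/2}e_{n-1}$ (so $Be_0=0$); that is, $\mathcal K\oplus\mathbb C$ with these two elements has the stated universal property. For $k\in\mathbb Z$ put $$\mathcal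 T\times_{(u^k\sigma,1)}\mathbb C=\{(t,\alpha)\in\mathcal T\times\mathbb C : u^k\sigma(t)=\alpha 1\},$$ a left $C(S_q^2)$-module via $(x+\alpha)\cdot(h,\beta)=((x+\alpha)h,\ \alpha\beta)$ for $x\in\mathcal K$, $\alpha\in\mathbb C$ (equivalently, via the action $(t,\alpha)\cdot(h,\beta)=(th,\alpha\beta)$ of $\mathcal T\times_{(\sigma,1)}\mathbb C\cong C(S_q^2)$, $(t,\alpha)\mapsto t$). Then for every $N\in\mathbb N$ there are isomorphisms of left $C(S_q^2)$-modules $$\mathcal T\times_{(u^N\sigma,1)}\mathbb C\;\cong\; C(S_q^2)^2\,p_N,\qquad p_N=\begin{pmatrix}1&0\\0&1-S^NS^{N*}\end{pmatrix},$$ $$\mathcal T\times_{(u^{-N}\sigma,1)}\mathbb C\;\cong\; C(S_q^2)\,p_{-N},\qquad p_{-N}=S^NS^{N*},$$ where $C(S_q^2)^2$ consists of row vectors, $C(S_q^2)^2p_N=\{vp_N : v\in C(S_q^2)^2\}$ and $C(S_q^2)p_{-N}=\{xp_{-N} : x\in C(S_q^2)\}$. -/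

import Mathlib

open scoped ENNReal Topology
open Filter InnerProductSpace

universe u

namespace QuantumSphere

noncomputable section

/-! ## Operators on the Hilbert space `ℓ²(ℕ)` -/

/-- The Hilbert space `ℓ²(ℕ)`. -/
abbrev Ell2 : Type := lp (fun _ : ℕ => ℂ) 2

/-- Bounded operators on `ℓ²(ℕ)`; `star` is the adjoint, `*` is composition. -/
abbrev Op : Type := Ell2 →L[ℂ] Ell2

/-! Shortcuts for instance search. -/

instance : AddCommGroup Ell2 := inferInstance
instance : AddCommMonoid Ell2 := inferInstance
instance : SeminormedAddCommGroup Ell2 := inferInstance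
instance : Module ℂ Ell2 := inferInstance
instance : CStarAlgebra Op := inferInstance
instance : NormedRing Op := inferInstance
instance : SeminormedAddCommGroup Op := inferInstance
instance : Ring Op := inferInstance
instance : Semiring Op := inferInstance
instance : AddCommGroup Op := inferInstance
instance : AddCommMonoid Op := inferInstance
instance : Module ℂ Op := inferInstance
instance : Algebra ℂ Op := inferInstance
instance : StarRing Op := inferInstance

/-- The standard orthonormal basis `e₀, e₁, …` of `ℓ²(ℕ)`. -/
def e (n : ℕ) : Ell2 := lp.single 2 n (1 : ℂ)

lemma e_apply (n m : ℕ) : e n m = if m = n then 1 else 0 := by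
  by_cases h : m = n
  · subst h; simp [e]
  · simp [e, h]

lemma norm_e (n : ℕ) : ‖e n‖ = 1 := by
  simp [e, lp.norm_single]

lemma inner_e_left (n : ℕ) (x : Ell2) : inner ℂ (e n) x = x n := by
  simp [e, lp.inner_single_left]

lemma inner_e_right (n : ℕ) (x : Ell2) : inner ℂ x (e n) = (starRingEnd ℂ) (x n) := by
  rw [← inner_conj_symm, inner_e_left]

lemma norm_sq (x : Ell2) : HasSum (fun n => ‖x n‖ ^ 2) (‖x‖ ^ 2) := by
  have := lp.hasSum_norm (E := fun _ : ℕ => ℂ) (p := 2) (by norm_num) x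
  simpa using this

/-- The sequence `(0, x₀, x₁, …)`. -/
def shiftFun (x : ℕ → ℂ) : ℕ → ℂ
  | 0 => 0
  | n + 1 => x n

lemma hasSum_shiftFun (x : Ell2) : HasSum (fun n => ‖shiftFun x n‖ ^ 2) (‖x‖ ^ 2) := by
  rw [hasSum_nat_add_iff' 1 |>.symm]
  simpa [shiftFun] using norm_sq x

lemma memℓp_shiftFun (x : Ell2) : Memℓp (shiftFun x) 2 :=
  memℓp_gen (by simpa using (hasSum_shiftFun x).summable)

/-- The unilateral shift `S eₙ = eₙ₊₁`, as an isometry of `ℓ²(ℕ)`. -/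
def shiftIsometry : Ell2 →ₗᵢ[ℂ] Ell2 where
  toFun x := ⟨shiftFun x, memℓp_shiftFun x⟩
  map_add' x y := by
    ext n
    cases n
    · exact (add_zero (0 : ℂ)).symm
    · rfl
  map_smul' c x := by
    ext n; cases n <;> simp [shiftFun]
  norm_map' x := by
    have h := (norm_sq ⟨shiftFun x, memℓp_shiftFun x⟩).unique (hasSum_shiftFun x)
    exact (pow_left_inj₀ (norm_nonneg _) (norm_nonneg _) two_ne_zero).1 h

/-- The unilateral shift `S` as a bounded operator. -/
def S : Op := shiftIsometry.toContinuousLinearMap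

lemma S_apply_zero (x : Ell2) : S x 0 = 0 := rfl

lemma S_apply_succ (x : Ell2) (n : ℕ) : S x (n + 1) = x n := rfl

lemma S_e (n : ℕ) : S (e n) = e (n + 1) := by
  ext m; cases m <;> simp [S_apply_zero, S_apply_succ, e_apply]

lemma star_S_apply (x : Ell2) (n : ℕ) : star S x n = x (n + 1) := by
  rw [← inner_e_left, ContinuousLinearMap.star_eq_adjoint,
    ContinuousLinearMap.adjoint_inner_right, S_e, inner_e_left]

lemma star_S_e_zero : star S (e 0) = 0 := by
  ext m; simp [star_S_apply, e_apply]

lemma star_S_e_succ (n : ℕ) : star S (e (n + 1)) = e n := by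
  ext m; simp [star_S_apply, e_apply]

lemma S_pow_e (k n : ℕ) : (S ^ k) (e n) = e (n + k) := by
  induction k with
  | zero => simp
  | succ k ih => rw [pow_succ', mul_apply_eq_comp, ih, S_e, add_assoc]

/-- The matrix unit `E i j = |eᵢ⟩⟨eⱼ|`. -/
def E (i j : ℕ) : Op := rankOne ℂ (e i) (e j)

lemma E_apply (i j : ℕ) (x : Ell2) : E i j x = x j • e i := by
  simp [E, inner_e_left]

lemma star_E (i j : ℕ) : star (E i j) = E j i := by
  simp [E, ContinuousLinearMap.star_eq_adjoint]

lemma norm_E (i j : ℕ) : ‖E i j‖ = 1 := by simp [E, norm_e]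

lemma one_sub_S_star : 1 - S * star S = E 0 0 := by
  ext x n
  cases n <;>
    simp [E_apply, e_apply, S_apply_zero, S_apply_succ, star_S_apply]

lemma S_pow_E_S_pow (i j : ℕ) : S ^ i * E 0 0 * star (S ^ j) = E i j := by
  have h : star (star (S ^ j)) (e 0) = e j := by rw [star_star, S_pow_e, zero_add]
  ext1 x
  have h2 : inner ℂ (e 0) (star (S ^ j) x) = inner ℂ (e j) x := by
    rw [← h, ContinuousLinearMap.star_eq_adjoint (star (S ^ j)),
      ContinuousLinearMap.adjoint_inner_left]
  simp only [mul_apply_eq_comp, E, rankOne_apply, map_smul, S_pow_e, zero_add, h2]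

/-- The projection onto the span of `e₀, …, eₙ₋₁`. -/
def P (n : ℕ) : Op := ∑ m ∈ Finset.range n, E m m

lemma star_P (n : ℕ) : star (P n) = P n := by simp [P, star_E]

lemma one_sub_S_pow (N : ℕ) : 1 - S ^ N * star (S ^ N) = P N := by
  induction N with
  | zero => simp [P]
  | succ N ih =>
    rw [P, Finset.sum_range_succ, ← P, ← ih, ← S_pow_E_S_pow, ← one_sub_S_star, pow_succ]
    simp only [star_mul]
    noncomm_ring

/-! ## The Toeplitz algebra and the symbol map -/


/-- The Toeplitz algebra: the `C*`-algebra generated by the unilateral shift. -/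
def Toeplitz : StarSubalgebra ℂ Op := StarAlgebra.elemental ℂ S

instance isClosed_toeplitz : IsClosed (Toeplitz : Set Op) := StarAlgebra.elemental.isClosed ℂ S

instance : CStarAlgebra Toeplitz := inferInstance
instance : Ring Toeplitz := inferInstance
instance : Semiring Toeplitz := inferInstance
instance : AddCommGroup Toeplitz := inferInstance
instance : AddCommMonoid Toeplitz := inferInstance
instance : Module ℂ Toeplitz := inferInstance
instance : StarRing Toeplitz := inferInstance

/-- The shift as an element of the Toeplitz algebra. -/
def shiftT : Toeplitz := ⟨S, StarAlgebra.elemental.self_mem ℂ S⟩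

/-- `u ^ k ∈ C(S¹)` for `k : ℤ`, where `u(z) = z`. -/
def uPow (k : ℤ) : C(Circle, ℂ) where
  toFun z := ((z ^ k : Circle) : ℂ)
  continuous_toFun := continuous_subtype_val.comp (continuous_zpow k)

/-- The vectors `∑_{k < n} z⁻ᵏ eₖ`, approximate eigenvectors of `S` and `S*`. -/
def xi (z : Circle) (n : ℕ) : Ell2 := ∑ k ∈ Finset.range n, ((z⁻¹ ^ k : Circle) : ℂ) • e k

lemma norm_sq_xi (z : Circle) (n : ℕ) : ‖xi z n‖ ^ 2 = n := by
  have := lp.norm_sum_single (E := fun _ : ℕ => ℂ) (p := 2) (by norm_num)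
    (fun k => ((z⁻¹ ^ k : Circle) : ℂ)) (Finset.range n)
  simp only [Circle.norm_coe] at this
  have h2 : xi z n = ∑ i ∈ Finset.range n, lp.single 2 i ((z⁻¹ ^ i : Circle) : ℂ) := by
    refine Finset.sum_congr rfl fun k _ => ?_
    ext m
    by_cases h : m = k
    · subst h; simp [e]
    · simp [e, h]
  rw [h2]
  simpa using this

lemma S_xi (z : Circle) (n : ℕ) : ‖S (xi z n) - (z : ℂ) • xi z n‖ ≤ 2 := by
  have h : S (xi z n) - (z : ℂ) • xi z n
      = (z : ℂ) • (((z⁻¹ ^ n : Circle) : ℂ) • e n - e 0) := by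
    induction n with
    | zero => simp [xi]
    | succ n ih =>
      have h1 : xi z (n + 1) = xi z n + ((z⁻¹ ^ n : Circle) : ℂ) • e n := by
        simp [xi, Finset.sum_range_succ]
      rw [h1, map_add, smul_add, add_sub_add_comm, ih, map_smul, S_e]
      have h3 : ((z⁻¹ ^ n : Circle) : ℂ) = (z : ℂ) * ((z⁻¹ ^ (n + 1) : Circle) : ℂ) := by
        rw [← Circle.coe_mul, pow_succ', mul_inv_cancel_left]
      nth_rewrite 2 [h3]
      module
  rw [h, norm_smul, Circle.norm_coe, one_mul]
  refine (norm_sub_le _ _).trans ?_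
  rw [norm_smul, Circle.norm_coe, norm_e, norm_e]
  norm_num

lemma star_S_xi (z : Circle) (n : ℕ) :
    ‖star S (xi z n) - (starRingEnd ℂ) (z : ℂ) • xi z n‖ ≤ 1 := by
  rw [← Circle.coe_inv_eq_conj]
  cases n with
  | zero => simp [xi]
  | succ n =>
    have h : star S (xi z (n + 1)) - ((z⁻¹ : Circle) : ℂ) • xi z (n + 1)
        = - (((z⁻¹ ^ (n + 1) : Circle) : ℂ) • e n) := by
      induction n with
      | zero => simp [xi, star_S_e_zero]
      | succ n ih =>
        have h1 : xi z (n + 1 + 1) = xi z (n + 1) + ((z⁻¹ ^ (n + 1) : Circle) : ℂ) • e (n + 1) := by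
          simp [xi, Finset.sum_range_succ]
        rw [h1, map_add, smul_add, add_sub_add_comm, ih, map_smul, star_S_e_succ,
          smul_smul, ← Circle.coe_mul, ← pow_succ']
        module
    rw [h, norm_neg, norm_smul, Circle.norm_coe, norm_e, one_mul]

/-- `f z` is an asymptotic eigenvalue of `t` along `xi z`, for every `z` in the circle. -/
def IsSymbol (x : Op × C(Circle, ℂ)) : Prop :=
  ∀ z : Circle, ∀ ε > 0, ∀ᶠ n : ℕ in atTop, ‖x.1 (xi z n) - x.2 z • xi z n‖ ≤ ε * ‖xi z n‖

lemma eventually_norm_xi (z : Circle) (C : ℝ) : ∀ᶠ n : ℕ in atTop, C ≤ ‖xi z n‖ := by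
  filter_upwards [eventually_ge_atTop ⌈C ^ 2⌉₊] with n hn
  have h : C ^ 2 ≤ n := Nat.ceil_le.1 hn
  rw [← norm_sq_xi z n] at h
  exact (abs_le_of_sq_le_sq' h (norm_nonneg _)).2

lemma IsSymbol.of_bounded {x : Op × C(Circle, ℂ)} {C : ℝ}
    (h : ∀ z n, ‖x.1 (xi z n) - x.2 z • xi z n‖ ≤ C) : IsSymbol x := by
  intro z ε hε
  filter_upwards [eventually_norm_xi z (C / ε)] with n hn
  refine (h z n).trans ?_
  rw [div_le_iff₀ hε] at hn
  linarith

lemma IsSymbol.add {x y : Op × C(Circle, ℂ)} (hx : IsSymbol x) (hy : IsSymbol y) :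
    IsSymbol (x + y) := by
  intro z ε hε
  filter_upwards [hx z (ε / 2) (half_pos hε), hy z (ε / 2) (half_pos hε)] with n h1 h2
  have h : (x + y).1 (xi z n) - (x + y).2 z • xi z n
      = (x.1 (xi z n) - x.2 z • xi z n) + (y.1 (xi z n) - y.2 z • xi z n) := by
    simp only [Prod.fst_add, Prod.snd_add, add_apply, ContinuousMap.add_apply]
    module
  rw [h]
  refine (norm_add_le _ _).trans ?_
  linarith

lemma IsSymbol.mul {x y : Op × C(Circle, ℂ)} (hx : IsSymbol x) (hy : IsSymbol y) :
    IsSymbol (x * y) := by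
  intro z ε hε
  have hA : 0 < ‖x.1‖ + ‖y.2 z‖ + 1 := by positivity
  have hδ : 0 < ε / (‖x.1‖ + ‖y.2 z‖ + 1) := by positivity
  filter_upwards [hx z _ hδ, hy z _ hδ] with n h1 h2
  have h : (x * y).1 (xi z n) - (x * y).2 z • xi z n
      = x.1 (y.1 (xi z n) - y.2 z • xi z n) + y.2 z • (x.1 (xi z n) - x.2 z • xi z n) := by
    simp only [Prod.fst_mul, Prod.snd_mul, mul_apply_eq_comp, ContinuousMap.mul_apply, map_sub,
      map_smul]
    module
  rw [h]
  refine (norm_add_le _ _).trans ?_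
  rw [norm_smul]
  have h3 : ‖x.1 (y.1 (xi z n) - y.2 z • xi z n)‖
      ≤ ‖x.1‖ * (ε / (‖x.1‖ + ‖y.2 z‖ + 1) * ‖xi z n‖) :=
    (x.1.le_opNorm _).trans (mul_le_mul_of_nonneg_left h2 (norm_nonneg _))
  have h4 : ‖y.2 z‖ * ‖x.1 (xi z n) - x.2 z • xi z n‖
      ≤ ‖y.2 z‖ * (ε / (‖x.1‖ + ‖y.2 z‖ + 1) * ‖xi z n‖) :=
    mul_le_mul_of_nonneg_left h1 (norm_nonneg _)
  have h5 : ε / (‖x.1‖ + ‖y.2 z‖ + 1) * (‖x.1‖ + ‖y.2 z‖ + 1) = ε := by field_simp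
  have h6 : 0 ≤ ε / (‖x.1‖ + ‖y.2 z‖ + 1) * ‖xi z n‖ := by positivity
  calc _ ≤ _ := add_le_add h3 h4
    _ ≤ (ε / (‖x.1‖ + ‖y.2 z‖ + 1) * (‖x.1‖ + ‖y.2 z‖ + 1)) * ‖xi z n‖ := by nlinarith
    _ = _ := by rw [h5]

lemma IsSymbol.closure {s : Set (Op × C(Circle, ℂ))} (hs : ∀ x ∈ s, IsSymbol x)
    {y : Op × C(Circle, ℂ)} (hy : y ∈ closure s) : IsSymbol y := by
  intro z ε hε
  obtain ⟨x, hx, hxy⟩ := Metric.mem_closure_iff.1 hy (ε / 3) (by positivity)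
  rw [dist_eq_norm] at hxy
  have h1 : ‖y.1 - x.1‖ ≤ ε / 3 := (norm_fst_le (y - x)).trans hxy.le
  have h2 : ‖y.2 z - x.2 z‖ ≤ ε / 3 :=
    ((y.2 - x.2).norm_coe_le_norm z).trans ((norm_snd_le (y - x)).trans hxy.le)
  filter_upwards [hs x hx z (ε / 3) (by positivity)] with n h3
  have h : y.1 (xi z n) - y.2 z • xi z n
      = (y.1 - x.1) (xi z n) + (x.1 (xi z n) - x.2 z • xi z n) - (y.2 z - x.2 z) • xi z n := by
    simp only [sub_apply]
    module
  rw [h]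
  refine (norm_sub_le _ _).trans ((add_le_add_left (norm_add_le _ _) _).trans ?_)
  rw [norm_smul]
  have h4 := ((y.1 - x.1).le_opNorm (xi z n)).trans
    (mul_le_mul_of_nonneg_right h1 (norm_nonneg _))
  have h5 := mul_le_mul_of_nonneg_right h2 (norm_nonneg (xi z n))
  linarith

/-- The closed `*`-subalgebra of `B(ℓ²(ℕ)) × C(S¹)` generated by `(S, u)`.  It is the graph of the
symbol map. -/
def symbolGraph : StarSubalgebra ℂ (Op × C(Circle, ℂ)) := StarAlgebra.elemental ℂ (S, uPow 1)

lemma isSymbol_of_mem {x : Op × C(Circle, ℂ)} (hx : x ∈ symbolGraph) : IsSymbol x := by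
  refine StarAlgebra.elemental.induction_on ℂ (P := fun y _ => IsSymbol y) hx ?_ ?_ ?_ ?_ ?_ ?_
  · refine IsSymbol.of_bounded (C := 2) fun z n => ?_
    simpa [uPow] using S_xi z n
  · refine IsSymbol.of_bounded (C := 1) fun z n => ?_
    simpa [uPow] using star_S_xi z n
  · intro r
    refine IsSymbol.of_bounded (C := 0) fun z n => ?_
    simp [Algebra.algebraMap_eq_smul_one]
  · exact fun _ _ _ _ h1 h2 => h1.add h2
  · exact fun _ _ _ _ h1 h2 => h1.mul h2
  · exact fun s _ h v hv => IsSymbol.closure h hv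

/-- The first projection of the graph. -/
def graphFst : symbolGraph →⋆ₐ[ℂ] Op := (StarAlgHom.fst ℂ Op C(Circle, ℂ)).comp symbolGraph.subtype

lemma graphFst_injective : Function.Injective graphFst := by
  rw [injective_iff_map_eq_zero]
  rintro ⟨⟨t, f⟩, hx⟩ h0
  have ht : t = 0 := h0
  subst ht
  have hf : f = 0 := by
    ext z
    by_contra hz
    have hz' : 0 < ‖f z‖ := norm_pos_iff.2 hz
    obtain ⟨n, h1, h2⟩ := ((isSymbol_of_mem hx z (‖f z‖ / 2) (half_pos hz')).and
      (eventually_norm_xi z 1)).exists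
    simp only [zero_apply, zero_sub, norm_neg, norm_smul] at h1
    nlinarith
  subst hf
  rfl

instance : IsClosed (symbolGraph : Set (Op × C(Circle, ℂ))) := StarAlgebra.elemental.isClosed ℂ _

lemma toeplitz_le_range : Toeplitz ≤ graphFst.range := by
  refine StarAlgebra.elemental.le_of_mem ?_ ?_
  · have := (NonUnitalStarAlgHom.isometry graphFst graphFst_injective).isClosedEmbedding.isClosed_range
    exact this
  · exact ⟨⟨(S, uPow 1), StarAlgebra.elemental.self_mem ℂ _⟩, rfl⟩

/-- The symbol map `σ : 𝒯 → C(S¹)`: the `*`-homomorphism with `σ(S) = u`, read off the graph. -/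
def symbol : Toeplitz →⋆ₐ[ℂ] C(Circle, ℂ) :=
  ((StarAlgHom.snd ℂ Op C(Circle, ℂ)).comp symbolGraph.subtype).comp
    (((StarAlgEquiv.ofInjective graphFst graphFst_injective).symm : _ →⋆ₐ[ℂ] symbolGraph).comp
      (StarSubalgebra.inclusion toeplitz_le_range))

lemma symbol_eq {t : Toeplitz} {f : C(Circle, ℂ)} (h : ((t : Op), f) ∈ symbolGraph) :
    symbol t = f := by
  have : (StarAlgEquiv.ofInjective graphFst graphFst_injective).symm
      (StarSubalgebra.inclusion toeplitz_le_range t) = ⟨((t : Op), f), h⟩ := by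
    rw [StarAlgEquiv.symm_apply_eq]
    rfl
  change ((StarAlgEquiv.ofInjective graphFst graphFst_injective).symm
      (StarSubalgebra.inclusion toeplitz_le_range t)).1.2 = f
  rw [this]

/-- The defining property of the symbol map: `σ(S) = u`. -/
lemma symbol_shiftT : symbol shiftT = uPow 1 := symbol_eq (StarAlgebra.elemental.self_mem ℂ _)

lemma continuous_starAlgHom (τ : Toeplitz →⋆ₐ[ℂ] C(Circle, ℂ)) : Continuous τ :=
  AddMonoidHomClass.continuous_of_bound τ 1 fun x => by
    rw [one_mul]
    exact NonUnitalStarAlgHom.norm_apply_le τ x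

/-- A `*`-homomorphism on the Toeplitz algebra is determined by its value on the shift. -/
lemma eq_symbol (τ : Toeplitz →⋆ₐ[ℂ] C(Circle, ℂ)) (h : τ shiftT = uPow 1) : τ = symbol :=
  StarAlgebra.elemental.starAlgHomClass_ext ℂ (a := S) (continuous_starAlgHom τ)
    (continuous_starAlgHom symbol)
    (h.trans symbol_shiftT.symm)

/-! ## Compact operators and the `C*`-algebra of the standard Podleś sphere -/


lemma P_apply (n : ℕ) (x : Ell2) : P n x = ∑ m ∈ Finset.range n, x m • e m := by
  simp [P, E_apply]

lemma tendsto_P (x : Ell2) : Tendsto (fun n => P n x) atTop (𝓝 x) := by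
  have h := (lp.hasSum_single (E := fun _ : ℕ => ℂ) (p := 2) (by norm_num) x).tendsto_sum_nat
  refine h.congr fun n => ?_
  rw [P_apply]
  refine Finset.sum_congr rfl fun k _ => ?_
  ext m
  by_cases hm : m = k
  · subst hm; simp [e]
  · simp [e, hm]

lemma isCompactOperator_E (i j : ℕ) : IsCompactOperator (E i j) := by
  have h : IsCompactOperator (innerSL ℂ (e j)) :=
    isCompactOperator_of_locallyCompactSpace_dom _
  exact h.clm_comp (ContinuousLinearMap.toSpanSingleton ℂ (e i))

lemma isCompactOperator_P (n : ℕ) : IsCompactOperator (P n) :=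
  Submodule.sum_mem (compactOperator (RingHom.id ℂ) Ell2 Ell2) fun m _ => isCompactOperator_E m m

lemma norm_P_le (n : ℕ) (x : Ell2) : ‖P n x‖ ≤ ‖x‖ := by
  have h := lp.norm_sum_single (E := fun _ : ℕ => ℂ) (p := 2) (by norm_num) x (Finset.range n)
  have h2 : P n x = ∑ i ∈ Finset.range n, lp.single 2 i (x i) := by
    rw [P_apply]
    refine Finset.sum_congr rfl fun k _ => ?_
    ext m
    by_cases hm : m = k
    · subst hm; simp [e]
    · simp [e, hm]
  rw [← h2] at h
  have h3 := sum_le_hasSum (Finset.range n) (fun i _ => by positivity) (norm_sq x)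
  have h4 : ‖P n x‖ ^ 2 ≤ ‖x‖ ^ 2 := by
    refine le_trans (le_of_eq ?_) h3
    simpa using h
  exact (pow_le_pow_iff_left₀ (norm_nonneg _) (norm_nonneg _) two_ne_zero).1 h4

lemma tendsto_P_mul {k : Op} (hk : IsCompactOperator k) :
    Tendsto (fun n => P n * k) atTop (𝓝 k) := by
  rw [Metric.tendsto_atTop]
  intro ε hε
  have hc := hk.isCompact_closure_image_closedBall (f := (k : Ell2 →ₗ[ℂ] Ell2)) 1
  have htb := hc.totallyBounded.subset subset_closure
  obtain ⟨t, ht, hcov⟩ := Metric.totallyBounded_iff.1 htb (ε / 6) (by positivity)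
  have hev : ∀ᶠ n in atTop, ∀ y ∈ t, ‖P n y - y‖ < ε / 6 := by
    rw [eventually_all_finite ht]
    intro y _
    simpa [dist_eq_norm] using (Metric.tendsto_nhds.1 (tendsto_P y)) (ε / 6) (by positivity)
  obtain ⟨N, hN⟩ := eventually_atTop.1 hev
  refine ⟨N, fun n hn => ?_⟩
  rw [dist_eq_norm]
  refine lt_of_le_of_lt (b := ε / 2) ?_ (by linarith)
  refine ContinuousLinearMap.opNorm_le_of_unit_norm (by positivity) fun x hx => ?_
  have hkx : k x ∈ (k : Ell2 →ₗ[ℂ] Ell2) '' Metric.closedBall 0 1 :=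
    ⟨x, by simp [hx], rfl⟩
  obtain ⟨y, hy, hxy⟩ := Set.mem_iUnion₂.1 (hcov hkx)
  rw [Metric.mem_ball, dist_eq_norm] at hxy
  have h : (P n * k - k) x = P n (k x - y) + (P n y - y) - (k x - y) := by
    simp only [sub_apply, mul_apply_eq_comp, map_sub]
    abel
  rw [h]
  refine (norm_sub_le _ _).trans ((add_le_add_left (norm_add_le _ _) _).trans ?_)
  have := norm_P_le n (k x - y)
  have := hN n hn y hy
  linarith

/-- The adjoint of a compact operator is compact. -/
lemma isCompactOperator_star {k : Op} (hk : IsCompactOperator k) :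
    IsCompactOperator (star k : Op) := by
  refine isCompactOperator_of_tendsto (l := atTop) ((continuous_star.tendsto k).comp (tendsto_P_mul hk))
    (Eventually.of_forall fun n => ?_)
  simp only [Function.comp, star_mul, star_P]
  exact (isCompactOperator_P n).clm_comp (star k)

lemma tendsto_P_mul_P {k : Op} (hk : IsCompactOperator k) :
    Tendsto (fun n => P n * k * P n) atTop (𝓝 k) := by
  have h1 := tendsto_P_mul hk
  have h2 := (continuous_star.tendsto _).comp (tendsto_P_mul (isCompactOperator_star hk))
  simp only [Function.comp_def, star_mul, star_P, star_star] at h2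
  have h3 : Tendsto (fun n => P n * (k * P n - k)) atTop (𝓝 0) := by
    rw [tendsto_zero_iff_norm_tendsto_zero]
    have h4 := (h2.sub_const k).norm
    simp only [sub_self, norm_zero] at h4
    refine squeeze_zero (fun n => norm_nonneg _) (fun n => ?_) h4
    refine (norm_mul_le _ _).trans ?_
    have : ‖P n‖ ≤ 1 := ContinuousLinearMap.opNorm_le_bound _ zero_le_one fun x => by
      simpa using norm_P_le n x
    nlinarith [norm_nonneg (k * P n - k)]
  have h5 := h3.add h1
  rw [zero_add] at h5
  refine h5.congr fun n => ?_
  noncomm_ring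

lemma P_mul_P (k : Op) (n : ℕ) :
    P n * k * P n = ∑ i ∈ Finset.range n, ∑ j ∈ Finset.range n, (k (e j) i) • E i j := by
  ext1 x
  simp only [P, Finset.sum_mul, Finset.mul_sum, sum_apply, mul_apply_eq_comp, smul_apply, E_apply,
    map_smul]
  rw [Finset.sum_comm]
  refine Finset.sum_congr rfl fun i _ => Finset.sum_congr rfl fun j _ => ?_
  simp [smul_smul, mul_comm]

lemma E_mem_toeplitz (i j : ℕ) : E i j ∈ Toeplitz := by
  rw [← S_pow_E_S_pow, ← one_sub_S_star]
  have hS : S ∈ Toeplitz := shiftT.2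
  exact mul_mem (mul_mem (pow_mem hS _) (sub_mem (one_mem _) (mul_mem hS (star_mem hS))))
    (star_mem (pow_mem hS _))

lemma symbol_E (i j : ℕ) : symbol ⟨E i j, E_mem_toeplitz i j⟩ = 0 := by
  have h : (⟨E i j, E_mem_toeplitz i j⟩ : Toeplitz)
      = shiftT ^ i * (1 - shiftT * star shiftT) * star (shiftT ^ j) := by
    apply Subtype.ext
    change E i j = S ^ i * (1 - S * star S) * star (S ^ j)
    rw [one_sub_S_star, S_pow_E_S_pow]
  have hu : uPow 1 * star (uPow 1) = 1 := by
    ext z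
    simp [uPow, Complex.mul_conj]
  rw [h, map_mul, map_mul, map_sub, map_mul, map_star, map_one, symbol_shiftT, hu]
  simp

lemma mem_toeplitz_of_compact {k : Op} (hk : IsCompactOperator k) : k ∈ Toeplitz := by
  refine (StarAlgebra.elemental.isClosed ℂ S).mem_of_tendsto (tendsto_P_mul_P hk)
    (Eventually.of_forall fun n => ?_)
  rw [P_mul_P]
  exact sum_mem fun i _ => sum_mem fun j _ => SMulMemClass.smul_mem _ (E_mem_toeplitz i j)

/-- The symbol map vanishes on compact operators. -/
lemma symbol_of_compact {k : Op} (hk : IsCompactOperator k) :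
    symbol ⟨k, mem_toeplitz_of_compact hk⟩ = 0 := by
  have hm (n : ℕ) : P n * k * P n ∈ Toeplitz := by
    rw [P_mul_P]
    exact sum_mem fun i _ => sum_mem fun j _ => SMulMemClass.smul_mem _ (E_mem_toeplitz i j)
  have h0 (n : ℕ) : symbol ⟨P n * k * P n, hm n⟩ = 0 := by
    have : (⟨P n * k * P n, hm n⟩ : Toeplitz) = ∑ i ∈ Finset.range n, ∑ j ∈ Finset.range n,
        (k (e j) i) • (⟨E i j, E_mem_toeplitz i j⟩ : Toeplitz) := by
      apply Subtype.ext
      simp [P_mul_P]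
    rw [this, map_sum]
    refine Finset.sum_eq_zero fun i _ => ?_
    rw [map_sum]
    exact Finset.sum_eq_zero fun j _ => by rw [map_smul, symbol_E, smul_zero]
  have ht : Tendsto (fun n => (⟨P n * k * P n, hm n⟩ : Toeplitz)) atTop
      (𝓝 ⟨k, mem_toeplitz_of_compact hk⟩) := tendsto_subtype_rng.2 (tendsto_P_mul_P hk)
  have h := ((continuous_starAlgHom symbol).tendsto _).comp ht
  simp only [Function.comp_def, h0] at h
  exact (tendsto_nhds_unique h tendsto_const_nhds)

/-- `𝒦(ℓ²(ℕ)) ⊕ ℂ ⊆ B(ℓ²(ℕ))`, the operators of the form `k + α` with `k` compact and `α ∈ ℂ`.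
This is the concrete form of the `C*`-algebra `C(S_q²)` of the standard Podleś sphere; that it has
the universal property of `C(S_q²)` with respect to the generators `genA q`, `genB q` is expressed
by `IsUniversalPodles q (genA q) (genB q)`. -/
def PodlesC : StarSubalgebra ℂ Op where
  carrier := {x | ∃ (k : Op) (α : ℂ), IsCompactOperator k ∧ x = k + algebraMap ℂ Op α}
  mul_mem' := by
    rintro _ _ ⟨k, α, hk, rfl⟩ ⟨h, β, hh, rfl⟩
    refine ⟨k * h + α • h + β • k, α * β, ?_, ?_⟩
    · exact ((hk.comp_clm h).add (hh.smul α)).add (hk.smul β)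
    · simp only [Algebra.algebraMap_eq_smul_one, mul_add, add_mul, smul_mul_assoc, mul_smul_comm,
        one_mul, mul_one]
      module
  add_mem' := by
    rintro _ _ ⟨k, α, hk, rfl⟩ ⟨h, β, hh, rfl⟩
    exact ⟨k + h, α + β, hk.add hh, by rw [map_add]; abel⟩
  algebraMap_mem' α := ⟨0, α, isCompactOperator_zero, by simp⟩
  star_mem' := by
    rintro _ ⟨k, α, hk, rfl⟩
    exact ⟨star k, star α, (isCompactOperator_star hk), by rw [star_add, algebraMap_star_comm]⟩

instance isClosed_podlesC : IsClosed (PodlesC : Set Op) := by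
  have h := Submodule.isClosed_sup_finiteDimensional
    (compactOperator (RingHom.id ℂ) Ell2 Ell2) (Submodule.span ℂ {(1 : Op)})
    isClosed_setOfPred_isCompactOperator
  convert h using 1
  ext x
  simp only [SetLike.mem_coe, Submodule.mem_sup, Submodule.mem_span_singleton]
  constructor
  · rintro ⟨k, α, hk, rfl⟩
    exact ⟨k, hk, _, ⟨α, rfl⟩, by rw [Algebra.algebraMap_eq_smul_one]⟩
  · rintro ⟨k, hk, _, ⟨α, rfl⟩, rfl⟩
    exact ⟨k, α, hk, by rw [Algebra.algebraMap_eq_smul_one]⟩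

lemma podlesC_le_toeplitz : PodlesC ≤ Toeplitz := by
  rintro _ ⟨k, α, hk, rfl⟩
  exact add_mem (mem_toeplitz_of_compact hk) (algebraMap_mem _ α)

/-- The inclusion of `𝒦(ℓ²(ℕ)) ⊕ ℂ` into the Toeplitz algebra. -/
def toToeplitz : PodlesC →⋆ₐ[ℂ] Toeplitz := StarSubalgebra.inclusion podlesC_le_toeplitz

/-- The character `k + α ↦ α`; it is the (constant) value of the symbol. -/
def counit : PodlesC →⋆ₐ[ℂ] ℂ where
  toFun x := symbol (toToeplitz x) 1
  map_one' := by simp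
  map_mul' x y := by simp
  map_zero' := by simp
  map_add' x y := by simp
  commutes' r := by simp [AlgHomClass.commutes]
  map_star' x := by simp [map_star]

lemma symbol_toToeplitz {x : PodlesC} {k : Op} {α : ℂ} (hk : IsCompactOperator k)
    (hx : (x : Op) = k + algebraMap ℂ Op α) :
    symbol (toToeplitz x) = algebraMap ℂ C(Circle, ℂ) α := by
  have : toToeplitz x = ⟨k, mem_toeplitz_of_compact hk⟩ + algebraMap ℂ Toeplitz α :=
    Subtype.ext hx
  rw [this, map_add, symbol_of_compact hk, zero_add, AlgHomClass.commutes]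

lemma counit_eq {x : PodlesC} {k : Op} {α : ℂ} (hk : IsCompactOperator k)
    (hx : (x : Op) = k + algebraMap ℂ Op α) : counit x = α := by
  change symbol (toToeplitz x) 1 = α
  rw [symbol_toToeplitz hk hx]
  simp

lemma symbol_eq_counit (x : PodlesC) :
    symbol (toToeplitz x) = algebraMap ℂ C(Circle, ℂ) (counit x) := by
  obtain ⟨k, α, hk, hx⟩ := x.2
  rw [counit_eq hk hx, symbol_toToeplitz hk hx]

/-- The operator `A eₙ = q²ⁿ eₙ`. -/
def opA (q : ℝ) : Op := ∑' n : ℕ, ((q ^ (2 * n) : ℝ) : ℂ) • E n n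

/-- The operator `B eₙ = qⁿ (1 - q²ⁿ)^{1/2} eₙ₋₁` for `n ≥ 1`, and `B e₀ = 0`. -/
def opB (q : ℝ) : Op :=
  ∑' n : ℕ, ((q ^ (n + 1) * √(1 - q ^ (2 * (n + 1))) : ℝ) : ℂ) • E n (n + 1)

lemma isCompactOperator_tsum {f : ℕ → Op} (hf : ∀ n, IsCompactOperator (f n)) :
    IsCompactOperator (∑' n, f n : Op) := by
  by_cases h : Summable f
  · refine isCompactOperator_of_tendsto h.hasSum.tendsto_sum_nat
      (Eventually.of_forall fun n => ?_)
    exact Submodule.sum_mem (compactOperator (RingHom.id ℂ) Ell2 Ell2) fun m _ => hf m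
  · rw [tsum_eq_zero_of_not_summable h]
    exact isCompactOperator_zero

lemma summable_opA {q : ℝ} (hq : q ∈ Set.Ioo (0 : ℝ) 1) :
    Summable fun n : ℕ => ((q ^ (2 * n) : ℝ) : ℂ) • E n n := by
  refine Summable.of_norm ?_
  simp only [norm_smul, norm_E, mul_one, Complex.norm_real, norm_pow, pow_mul]
  refine summable_geometric_of_lt_one (by positivity) ?_
  rw [Real.norm_of_nonneg hq.1.le]
  nlinarith [hq.1, hq.2]

lemma opA_e {q : ℝ} (hq : q ∈ Set.Ioo (0 : ℝ) 1) (n : ℕ) :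
    opA q (e n) = ((q ^ (2 * n) : ℝ) : ℂ) • e n := by
  have h := (summable_opA hq).hasSum.mapL (ContinuousLinearMap.apply ℂ Ell2 (e n))
  have h2 := hasSum_single (f := fun m => (ContinuousLinearMap.apply ℂ Ell2 (e n))
    (((q ^ (2 * m) : ℝ) : ℂ) • E m m)) n (fun m hm => by simp [E_apply, e_apply, hm])
  refine (h.unique h2).trans ?_
  simp [E_apply, e_apply]

lemma summable_opB {q : ℝ} (hq : q ∈ Set.Ioo (0 : ℝ) 1) :
    Summable fun n : ℕ =>
      ((q ^ (n + 1) * √(1 - q ^ (2 * (n + 1))) : ℝ) : ℂ) • E n (n + 1) := by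
  refine Summable.of_norm_bounded (g := fun n : ℕ => q ^ n)
    (summable_geometric_of_lt_one hq.1.le hq.2) fun n => ?_
  have h0 := hq.1.le
  rw [norm_smul, norm_E, mul_one, Complex.norm_real, Real.norm_of_nonneg (by positivity)]
  have h1 : √(1 - q ^ (2 * (n + 1))) ≤ 1 := Real.sqrt_le_one.2 (by simp; positivity)
  have h2 : 0 ≤ q ^ n := by positivity
  have h3 : q ^ (n + 1) ≤ q ^ n := pow_le_pow_of_le_one h0 hq.2.le (by omega)
  have h4 : 0 ≤ q ^ (n + 1) := by positivity
  nlinarith [Real.sqrt_nonneg (1 - q ^ (2 * (n + 1)))]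

lemma opB_e_zero {q : ℝ} (hq : q ∈ Set.Ioo (0 : ℝ) 1) : opB q (e 0) = 0 := by
  have h := (summable_opB hq).hasSum.mapL (ContinuousLinearMap.apply ℂ Ell2 (e 0))
  refine h.unique ?_
  simp [E_apply, e_apply, hasSum_zero]

lemma opB_e_succ {q : ℝ} (hq : q ∈ Set.Ioo (0 : ℝ) 1) (n : ℕ) :
    opB q (e (n + 1)) = ((q ^ (n + 1) * √(1 - q ^ (2 * (n + 1))) : ℝ) : ℂ) • e n := by
  have h := (summable_opB hq).hasSum.mapL (ContinuousLinearMap.apply ℂ Ell2 (e (n + 1)))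
  have h2 := hasSum_single (f := fun m => (ContinuousLinearMap.apply ℂ Ell2 (e (n + 1)))
    (((q ^ (m + 1) * √(1 - q ^ (2 * (m + 1))) : ℝ) : ℂ) • E m (m + 1))) n
    (fun m hm => by simp [E_apply, e_apply, hm])
  refine (h.unique h2).trans ?_
  simp [E_apply, e_apply]

/-- A compact operator as an element of `𝒦(ℓ²(ℕ)) ⊕ ℂ`. -/
def ofCompact (k : Op) (hk : IsCompactOperator k) : PodlesC := ⟨k, k, 0, hk, by simp⟩

/-- The generator `A` in its representation on `ℓ²(ℕ)`. -/
def genA (q : ℝ) : PodlesC := ofCompact (opA q)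
  (isCompactOperator_tsum fun n => (isCompactOperator_E n n).smul (_ : ℂ))

/-- The generator `B` in its representation on `ℓ²(ℕ)`. -/
def genB (q : ℝ) : PodlesC := ofCompact (opB q)
  (isCompactOperator_tsum fun n => (isCompactOperator_E n (n + 1)).smul (_ : ℂ))

/-- The defining relations of the coordinate ring of the standard Podleś sphere. -/
structure PodlesRelations (q : ℝ) {D : Type*} [CStarAlgebra D] (a b : D) : Prop where
  star_a : star a = a
  ba : b * a = ((q : ℂ) ^ 2) • (a * b)
  star_b_mul_b : star b * b = a - a ^ 2
  b_mul_star_b : b * star b = ((q : ℂ) ^ 2) • a - ((q : ℂ) ^ 4) • a ^ 2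

/-- `𝒜` is the universal unital `C*`-algebra generated by elements `A`, `B` subject to the
relations of the standard Podleś sphere. -/
structure IsUniversalPodles (q : ℝ) {𝒜 : Type} [CStarAlgebra 𝒜] (A B : 𝒜) : Prop where
  relations : PodlesRelations q A B
  existsUnique_lift : ∀ (D : Type u) [CStarAlgebra D] (a b : D), PodlesRelations q a b →
    ∃! φ : 𝒜 →⋆ₐ[ℂ] D, φ A = a ∧ φ B = b

/-! ## The fibre-product modules and the projections -/

/-- The fibre product `𝒯 ×_{(uᵏσ, 1)} ℂ`: pairs `(t, α)` with `uᵏ σ(t) = α · 1`. -/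
def FibreProduct (k : ℤ) : AddSubgroup (Toeplitz × ℂ) where
  carrier := {p | uPow k * symbol p.1 = algebraMap ℂ C(Circle, ℂ) p.2}
  zero_mem' := by simp
  add_mem' := by
    intro p p' hp hp'
    simp only [Set.mem_ofPred_eq, Prod.fst_add, Prod.snd_add, map_add, mul_add] at *
    rw [hp, hp']
  neg_mem' := by
    intro p hp
    simp only [Set.mem_ofPred_eq, Prod.fst_neg, Prod.snd_neg, map_neg, mul_neg] at *
    rw [hp]

/-- The left action `(k + α) • (h, β) = ((k + α) h, α β)`, that is, the action
`(t, α) • (h, β) = (t h, α β)` of `𝒯 ×_{(σ, 1)} ℂ`, transported along `(t, α) ↦ t`. -/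
instance (k : ℤ) : Module PodlesC (FibreProduct k) where
  smul x p := ⟨(toToeplitz x * p.1.1, counit x * p.1.2), by
    have hp : uPow k * symbol p.1.1 = algebraMap ℂ C(Circle, ℂ) p.1.2 := p.2
    change uPow k * symbol (toToeplitz x * p.1.1) = algebraMap ℂ C(Circle, ℂ) (counit x * p.1.2)
    rw [map_mul, map_mul, symbol_eq_counit, ← hp, mul_left_comm]⟩
  one_smul p := Subtype.ext (Prod.ext (by change toToeplitz 1 * _ = _; simp)
    (by change counit 1 * _ = _; simp))
  mul_smul x y p := Subtype.ext (Prod.ext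
    (by change toToeplitz (x * y) * _ = _ * (_ * _); rw [map_mul, mul_assoc])
    (by change counit (x * y) * _ = _ * (_ * _); rw [map_mul, mul_assoc]))
  smul_zero x := Subtype.ext (Prod.ext (mul_zero _) (mul_zero _))
  zero_smul p := Subtype.ext (Prod.ext (by change toToeplitz 0 * _ = 0; simp)
    (by change counit 0 * _ = 0; simp))
  smul_add x p p' := Subtype.ext (Prod.ext (mul_add _ _ _) (mul_add _ _ _))
  add_smul x y p := Subtype.ext (Prod.ext
    (by change toToeplitz (x + y) * _ = _ * _ + _ * _; rw [map_add, add_mul])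
    (by change counit (x + y) * _ = _ * _ + _ * _; rw [map_add, add_mul]))

/-- The element `p_{-N} = Sᴺ (Sᴺ)*` of `𝒦(ℓ²(ℕ)) ⊕ ℂ`. -/
def projNeg (N : ℕ) : PodlesC := ⟨S ^ N * star (S ^ N), -P N, 1, (isCompactOperator_P N).neg, by
  rw [← one_sub_S_pow, map_one]; abel⟩

/-- The matrix `p_N = diag(1, 1 - Sᴺ (Sᴺ)*)`. -/
def projPos (N : ℕ) : Matrix (Fin 2) (Fin 2) PodlesC := !![1, 0; 0, 1 - projNeg N]

/-- The left module `Rⁿ p = {v p : v ∈ Rⁿ}` of row vectors defined by a square matrix `p`. -/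
def rowModule {R : Type*} [Ring R] {n : Type*} [Fintype n] (p : Matrix n n R) :
    Submodule R (n → R) :=
  LinearMap.range p.vecMulLinear

end

end QuantumSphere

namespace QuantumSphere

noncomputable section

/-! ## The generators on the standard basis -/

/-! The module isomorphisms rest on two facts. Right multiplication by `S ^ N` or its adjoint shifts
the symbol by `u ^ N` or `u ^ (-N)`, and the kernel of the symbol map is exactly the compacts, so a
Toeplitz element with constant symbol lies in 𝒦 ⊕ ℂ. For `-N` the map `h ↦ h (S ^ N)*` lands in 𝒦 ⊕
ℂ and is undone by `S ^ N`, because `(S ^ N)* S ^ N = 1`. For `N` the map `h ↦ h S ^ N` forgets the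
finite-rank part `h (1 - S ^ N (S ^ N)*)`; the second coordinate records it.

That the kernel contains only compacts (`isCompactOperator_of_symbol_eq_zero`) follows by
compressing the functional calculus of a unitary dilation of `S` to a continuous linear map `f ↦
T_f`. Every Toeplitz element `t` differs from `T_{σ(t)}` by a compact (`isToeplitzModCompact`), and
`T_0 = 0`.

For universality, given `a`, `b` satisfying the relations in `D`, the lift is read off its graph,
the C*-algebra generated by `(A, a)` and `(B, b)` in `Op × D`. The point is that the first
projection is injective there (`eq_zero_of_fst_eq_zero`). The relations force the spectrum of any
solution `a` into `{0} ∪ {q ^ (2n)}`, with spectral projections `p_n` linked by `b` and `b*`, and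
the corner at `p_0` is spanned by `p_0` (`proj_mul_mul_proj`). If `w` has first coordinate `0`, then
`p_0 w* w p_0 = c p_0` with `c = 0`, so `w p_0 = 0`; climbing the ladder gives `w p_n = 0` for all
`n`. As the generator is the norm-convergent sum of the `q ^ (2n) p_n`, `w` annihilates both
generators from the left, and this forces `w w* = 0`. The projection is onto 𝒦 ⊕ ℂ, and lifts are
unique, because `A` and `B` generate this algebra (`podlesC_le_of_mem`). -/

lemma op_ext {x y : Op} (h : ∀ n, x (e n) = y (e n)) : x = y := by
  ext1 v
  refine tendsto_nhds_unique ((x.continuous.tendsto v).comp (tendsto_P v)) ?_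
  refine ((y.continuous.tendsto v).comp (tendsto_P v)).congr fun n => ?_
  simp [Function.comp, P_apply, h]

/-- The weights of the operator `B`. -/
def weight (q : ℝ) (n : ℕ) : ℝ := q ^ (n + 1) * √(1 - q ^ (2 * (n + 1)))

lemma weight_sq {q : ℝ} (hq : q ∈ Set.Ioo (0 : ℝ) 1) (n : ℕ) :
    weight q n * weight q n = q ^ (2 * (n + 1)) - (q ^ (2 * (n + 1))) ^ 2 := by
  have h1 : q ^ (2 * (n + 1)) ≤ 1 := pow_le_one₀ hq.1.le hq.2.le
  have h2 := Real.mul_self_sqrt (sub_nonneg.2 h1)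
  rw [weight, mul_mul_mul_comm, h2]
  ring

lemma weight_pos {q : ℝ} (hq : q ∈ Set.Ioo (0 : ℝ) 1) (n : ℕ) : 0 < weight q n := by
  have h1 : q ^ (2 * (n + 1)) < 1 := pow_lt_one₀ hq.1.le hq.2 (by omega)
  exact mul_pos (pow_pos hq.1 _) (Real.sqrt_pos.2 (sub_pos.2 h1))

lemma star_opA (q : ℝ) : star (opA q) = opA q := by
  rw [opA, tsum_star]
  refine tsum_congr fun n => ?_
  rw [star_smul, star_E]
  simp

lemma star_opB_e {q : ℝ} (hq : q ∈ Set.Ioo (0 : ℝ) 1) (n : ℕ) :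
    star (opB q) (e n) = (weight q n : ℂ) • e (n + 1) := by
  ext m
  rw [← inner_e_left, ContinuousLinearMap.star_eq_adjoint,
    ContinuousLinearMap.adjoint_inner_right, lp.coeFn_smul, Pi.smul_apply, smul_eq_mul]
  cases m with
  | zero => simp [opB_e_zero hq, e_apply]
  | succ m =>
    rw [opB_e_succ hq, inner_smul_left, inner_e_left, ← weight]
    by_cases hm : m = n
    · subst hm; simp [e_apply]
    · simp [e_apply, hm]

lemma podlesRelations_op {q : ℝ} (hq : q ∈ Set.Ioo (0 : ℝ) 1) :
    PodlesRelations q (opA q) (opB q) where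
  star_a := star_opA q
  ba := by
    refine op_ext fun n => ?_
    cases n with
    | zero => simp [mul_apply_eq_comp, opA_e hq, opB_e_zero hq]
    | succ n =>
      simp only [mul_apply_eq_comp, smul_apply, opA_e hq, opB_e_succ hq, map_smul, smul_smul]
      congr 1
      push_cast
      ring
  star_b_mul_b := by
    refine op_ext fun n => ?_
    cases n with
    | zero => simp [mul_apply_eq_comp, opA_e hq, opB_e_zero hq, pow_two]
    | succ n =>
      simp only [mul_apply_eq_comp, sub_apply, pow_two (opA q), opA_e hq, opB_e_succ hq,
        star_opB_e hq, map_smul, smul_smul, ← sub_smul]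
      congr 1
      have := weight_sq hq n
      rw [← weight]
      exact_mod_cast this.trans (by ring)
  b_mul_star_b := by
    refine op_ext fun n => ?_
    simp only [mul_apply_eq_comp, sub_apply, smul_apply, pow_two (opA q), opA_e hq, opB_e_succ hq,
      star_opB_e hq, map_smul, smul_smul, ← sub_smul]
    congr 1
    have := weight_sq hq n
    rw [← weight]
    exact_mod_cast this.trans (by ring)

lemma podlesRelations_gen {q : ℝ} (hq : q ∈ Set.Ioo (0 : ℝ) 1) :
    PodlesRelations q (genA q) (genB q) where
  star_a := Subtype.ext (podlesRelations_op hq).star_a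
  ba := Subtype.ext (podlesRelations_op hq).ba
  star_b_mul_b := Subtype.ext (podlesRelations_op hq).star_b_mul_b
  b_mul_star_b := Subtype.ext (podlesRelations_op hq).b_mul_star_b

/-! ### Generation of 𝒦 ⊕ ℂ by `A` and `B` -/

lemma E_mul_E (i j k : ℕ) : E i j * E j k = E i k := by
  ext1 x
  simp [mul_apply_eq_comp, E_apply, e_apply]

/-- The powers of `A` converge in norm to the projection onto `e₀`. -/
lemma tendsto_opA_pow {q : ℝ} (hq : q ∈ Set.Ioo (0 : ℝ) 1) :
    Tendsto (fun n => opA q ^ n) atTop (𝓝 (E 0 0)) := by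
  -- Split off the eigenvalue `1`: the rest `R` is orthogonal to `E 0 0` on both sides and has norm
  -- at most `q ^ 2 < 1`, so its powers die out.
  set R : Op := opA q - E 0 0 with hR
  have hA : opA q = E 0 0 + R := by rw [hR]; abel
  have hAE : opA q * E 0 0 = E 0 0 := by
    ext1 x
    simp [mul_apply_eq_comp, E_apply, opA_e hq]
  have hEE : E 0 0 * E 0 0 = E 0 0 := E_mul_E 0 0 0
  have hEA : E 0 0 * opA q = E 0 0 := by
    have := congrArg star hAE
    rwa [star_mul, star_opA, star_E] at this
  have hRE : R * E 0 0 = 0 := by rw [hR, sub_mul, hAE, hEE, sub_self]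
  have hER : E 0 0 * R = 0 := by rw [hR, mul_sub, hEA, hEE, sub_self]
  have hpow : ∀ n, opA q ^ (n + 1) = E 0 0 + R ^ (n + 1) := by
    intro n
    induction n with
    | zero => simpa using hA
    | succ n ih =>
      rw [pow_succ, ih, hA, mul_add, add_mul, add_mul, hEE, hER, pow_succ R n, mul_assoc, hRE,
        ← pow_succ, ← pow_succ]
      simp
  have hnorm : ‖R‖ ≤ q ^ 2 := by
    refine ContinuousLinearMap.opNorm_le_bound _ (by positivity) fun x => ?_
    have hcoord : ∀ n, ‖R x n‖ ≤ ‖((q ^ 2 : ℝ) : ℂ) • x n‖ := by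
      intro n
      have hRn : star R (e n) = ((if n = 0 then 0 else q ^ (2 * n) : ℝ) : ℂ) • e n := by
        rw [hR, star_sub, star_opA, star_E, sub_apply, opA_e hq, E_apply]
        rcases eq_or_ne n 0 with rfl | hn
        · simp [e_apply]
        · simp [e_apply, hn, Ne.symm hn]
      have : R x n = ((if n = 0 then 0 else q ^ (2 * n) : ℝ) : ℂ) * x n := by
        rw [← inner_e_left, ← inner_e_left n x, ← star_star R,
          ContinuousLinearMap.star_eq_adjoint (star R), ContinuousLinearMap.adjoint_inner_right,
          hRn, inner_smul_left, Complex.conj_ofReal]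
      rw [this, norm_mul, norm_smul]
      refine mul_le_mul_of_nonneg_right ?_ (norm_nonneg _)
      rw [Complex.norm_real, Complex.norm_real, Real.norm_of_nonneg (sq_nonneg q)]
      split_ifs with h
      · simp; positivity
      · rw [Real.norm_of_nonneg (pow_nonneg hq.1.le _)]
        exact pow_le_pow_of_le_one hq.1.le hq.2.le (by omega)
    have h1 := norm_sq (R x)
    have h2 := norm_sq (((q ^ 2 : ℝ) : ℂ) • x)
    have h3 : ‖R x‖ ^ 2 ≤ ‖((q ^ 2 : ℝ) : ℂ) • x‖ ^ 2 :=
      hasSum_le (fun n => pow_le_pow_left₀ (norm_nonneg _) (hcoord n) 2) h1 h2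
    have h4 := (pow_le_pow_iff_left₀ (norm_nonneg _) (norm_nonneg _) two_ne_zero).1 h3
    rwa [norm_smul, Complex.norm_real, Real.norm_of_nonneg (by positivity)] at h4
  have hR0 : Tendsto (fun n => R ^ n) atTop (𝓝 0) := by
    refine tendsto_pow_atTop_nhds_zero_of_norm_lt_one (lt_of_le_of_lt hnorm ?_)
    nlinarith [hq.1, hq.2]
  -- The formula for powers fails at exponent `0`, so the sequence is shifted by one.
  rw [← tendsto_add_atTop_iff_nat 1]
  simp only [hpow]
  simpa using ((tendsto_add_atTop_iff_nat 1).2 hR0).const_add (E 0 0)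

/-- `A` and `B` generate `𝒦 ⊕ ℂ` as a `C*`-algebra. -/
lemma podlesC_le_of_mem {q : ℝ} (hq : q ∈ Set.Ioo (0 : ℝ) 1) {M : StarSubalgebra ℂ Op}
    (hM : IsClosed (M : Set Op)) (hA : opA q ∈ M) (hB : opB q ∈ M) : PodlesC ≤ M := by
  have h00 : E 0 0 ∈ M :=
    hM.mem_of_tendsto (tendsto_opA_pow hq) (Eventually.of_forall fun n => pow_mem hA n)
  -- `B*` climbs the basis with nonzero weights, so it produces the whole first column of matrix
  -- units from `E 0 0`.
  have hi0 : ∀ i, E i 0 ∈ M := by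
    intro i
    induction i with
    | zero => exact h00
    | succ i ih =>
      have hw : (weight q i : ℂ) ≠ 0 := by exact_mod_cast (weight_pos hq i).ne'
      have : E (i + 1) 0 = (weight q i : ℂ)⁻¹ • (star (opB q) * E i 0) := by
        ext1 x
        simp only [smul_apply, mul_apply_eq_comp, E_apply, map_smul, star_opB_e hq, smul_smul]
        congr 1
        field_simp
      rw [this]
      exact SMulMemClass.smul_mem _ (mul_mem (star_mem hB) ih)
  have hE : ∀ i j, E i j ∈ M := fun i j => by
    rw [← E_mul_E i 0 j, ← star_E j 0]
    exact mul_mem (hi0 i) (star_mem (hi0 j))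
  rintro _ ⟨k, α, hk, rfl⟩
  refine add_mem (hM.mem_of_tendsto (tendsto_P_mul_P hk) (Eventually.of_forall fun n => ?_))
    (algebraMap_mem _ α)
  rw [P_mul_P]
  exact sum_mem fun i _ => sum_mem fun j _ => SMulMemClass.smul_mem _ (hE i j)

end

end QuantumSphere

namespace QuantumSphere

noncomputable section

/-! ## Spectral projections at isolated points -/

/-- A continuous function equal to `1 / (t - μ)` at distance at least `δ` from `μ`. -/
def truncInv (μ δ t : ℝ) : ℝ := (t - μ) / max ((t - μ) ^ 2) (δ ^ 2)

/-- A continuous function with value `1` at `μ`, vanishing at distance at least `δ` from `μ`. -/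
def bump (μ δ t : ℝ) : ℝ := 1 - truncInv μ δ t * (t - μ)

lemma continuous_truncInv (μ : ℝ) {δ : ℝ} (hδ : 0 < δ) : Continuous (truncInv μ δ) := by
  unfold truncInv
  refine Continuous.div (by fun_prop) (by fun_prop) fun t => ?_
  have : 0 < max ((t - μ) ^ 2) (δ ^ 2) := lt_max_of_lt_right (by positivity)
  exact this.ne'

lemma continuous_bump (μ : ℝ) {δ : ℝ} (hδ : 0 < δ) : Continuous (bump μ δ) := by
  have := continuous_truncInv μ hδ
  unfold bump
  fun_prop

lemma bump_self (μ δ : ℝ) : bump μ δ μ = 1 := by simp [bump]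

lemma bump_eq_zero {μ δ t : ℝ} (hδ : 0 < δ) (h : δ ≤ |t - μ|) : bump μ δ t = 0 := by
  have h1 : δ ^ 2 ≤ (t - μ) ^ 2 := by
    rw [← sq_abs (t - μ)]
    exact pow_le_pow_left₀ hδ.le h 2
  have h2 : t - μ ≠ 0 := by
    intro h0
    rw [h0, abs_zero] at h
    linarith
  rw [bump, truncInv, max_eq_left h1]
  field_simp
  ring

section SpectralProjection

variable {C : Type*} [CStarAlgebra C] {a : C} {μ δ : ℝ}

/-- The spectral projection of `a` at a point `μ` of the spectrum that is isolated with gap `δ`. -/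
def spectralProj (a : C) (μ δ : ℝ) : C := cfc (bump μ δ) a

lemma star_spectralProj : star (spectralProj a μ δ) = spectralProj a μ δ :=
  (cfc_predicate (bump μ δ) a : IsSelfAdjoint _)

/-- Holds with no gap assumption: the maximum in `truncInv` keeps it continuous through `μ`, so `1 -
bump` is divisible by `t - μ` among continuous functions. Hence the complement of the projection
kills every `μ`-eigenvector. -/
lemma one_sub_spectralProj (ha : IsSelfAdjoint a) (hδ : 0 < δ) :
    1 - spectralProj a μ δ = cfc (truncInv μ δ) a * (a - μ • (1 : C)) := by
  have h1 := (continuous_truncInv μ hδ).continuousOn (s := spectrum ℝ a)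
  have h2 : cfc (fun t : ℝ => t - μ) a = a - μ • (1 : C) := by
    rw [cfc_sub (fun t : ℝ => t) (fun _ => μ) a, cfc_id' ℝ a, cfc_const μ a,
      Algebra.algebraMap_eq_smul_one]
  have h3 : cfc (bump μ δ) a = 1 - cfc (fun t => truncInv μ δ t * (t - μ)) a := by
    rw [← cfc_const_one ℝ a, ← cfc_sub (fun _ : ℝ => (1 : ℝ)) _ a]
    rfl
  rw [spectralProj, h3, sub_sub_cancel, cfc_mul _ _ a, h2]

lemma spectralProj_mul_of_eq (ha : IsSelfAdjoint a) (hδ : 0 < δ) {y : C} (hy : a * y = μ • y) :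
    spectralProj a μ δ * y = y := by
  have h : (1 - spectralProj a μ δ) * y = 0 := by
    rw [one_sub_spectralProj ha hδ, mul_assoc, sub_mul, hy, smul_mul_assoc, one_mul, sub_self,
      mul_zero]
  rw [sub_mul, one_mul, sub_eq_zero] at h
  exact h.symm

/-- Here the gap is needed: on the spectrum `bump` vanishes away from `μ`, so `t * bump` and `μ *
bump` agree there. -/
lemma mul_spectralProj (ha : IsSelfAdjoint a) (hδ : 0 < δ)
    (hs : ∀ t ∈ spectrum ℝ a, t ≠ μ → δ ≤ |t - μ|) :
    a * spectralProj a μ δ = μ • spectralProj a μ δ := by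
  have h1 := (continuous_bump μ hδ).continuousOn (s := spectrum ℝ a)
  have h2 : cfc (fun t => t * bump μ δ t) a = cfc (fun t => μ • bump μ δ t) a := by
    refine cfc_congr fun t ht => ?_
    rcases eq_or_ne t μ with rfl | hne
    · rfl
    · simp [bump_eq_zero hδ (hs t ht hne)]
  rw [cfc_mul (fun t : ℝ => t) _ a, cfc_smul μ _ a, cfc_id' ℝ a] at h2
  exact h2

end SpectralProjection

/-! ## Consequences of the Podleś relations -/

namespace PodlesRelations

variable {q : ℝ} {C : Type*} [CStarAlgebra C] {a b : C}

lemma real_ba (h : PodlesRelations q a b) : b * a = (q ^ 2) • (a * b) := by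
  rw [h.ba, ← Complex.coe_smul]
  norm_num

lemma a_mul_star_b (h : PodlesRelations q a b) : a * star b = (q ^ 2) • (star b * a) := by
  have := congrArg star h.real_ba
  simpa [h.star_a] using this

/-- The relation gives `b (a - t) = q ^ 2 (a - t / q ^ 2) b`. If `a - t / q ^ 2` were invertible,
`b`, and hence `b* b = a - a ^ 2`, would be a left multiple of `a - t`. Since `a - a ^ 2 = t (1 - t)
+ (1 - t - a) (a - t)` and `t (1 - t) ≠ 0`, the self-adjoint `a - t` would be left invertible, hence
invertible. -/
lemma spectrum_step (h : PodlesRelations q a b) (hq : q ∈ Set.Ioo (0 : ℝ) 1) {t : ℝ}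
    (ht : t ∈ spectrum ℝ a) (h0 : t ≠ 0) (h1 : t ≠ 1) : t / q ^ 2 ∈ spectrum ℝ a := by
  have hq0 : q ^ 2 ≠ 0 := pow_ne_zero _ hq.1.ne'
  by_contra hnot
  rw [spectrum.notMem_iff] at hnot
  obtain ⟨v, hv⟩ := hnot
  refine (spectrum.mem_iff.1 ht) ?_
  set c : C := a - t • (1 : C) with hc
  -- The unit `v` is `t / q ^ 2 - a`, the opposite sign to `c`; hence the minus signs below.
  have hbc : b * c = -(q ^ 2) • ((v : C) * b) := by
    rw [hc, hv, mul_sub, sub_mul, h.real_ba, Algebra.algebraMap_eq_smul_one, smul_mul_assoc,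
      one_mul, mul_smul_comm, mul_one, smul_sub, smul_smul, neg_mul, mul_div_cancel₀ _ hq0]
    module
  have hb : b = -(q ^ 2)⁻¹ • (((v⁻¹ : Cˣ) : C) * b * c) := by
    rw [mul_assoc, hbc, mul_smul_comm, ← mul_assoc, Units.inv_mul, one_mul, smul_smul]
    rw [neg_mul_neg, inv_mul_cancel₀ hq0, one_smul]
  set y : C := -(q ^ 2)⁻¹ • (star b * ((v⁻¹ : Cˣ) : C) * b) with hy
  have hyc : y * c = a - a ^ 2 := by
    rw [← h.star_b_mul_b]
    conv_rhs => rw [hb, mul_smul_comm]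
    rw [hy, smul_mul_assoc, ← hb]
    simp only [mul_assoc]
  have key : (y - ((1 - t) • (1 : C) - a)) * c = (t * (1 - t)) • (1 : C) := by
    rw [sub_mul, hyc, hc]
    simp only [sub_mul, mul_sub, smul_mul_assoc, mul_smul_comm, one_mul, mul_one, pow_two]
    module
  have hne : t * (1 - t) ≠ 0 := mul_ne_zero h0 (sub_ne_zero.2 h1.symm)
  set l : C := (t * (1 - t))⁻¹ • (y - ((1 - t) • (1 : C) - a)) with hl
  have hlc : l * c = 1 := by
    rw [hl, smul_mul_assoc, key, smul_smul, inv_mul_cancel₀ hne, one_smul]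
  have hcs : star c = c := by simp [hc, h.star_a]
  have hcl : c * star l = 1 := by
    have := congrArg star hlc
    rwa [star_mul, hcs, star_one] at this
  have hcu : IsUnit c := ⟨⟨c, l, by rw [left_inv_eq_right_inv hlc hcl, hcl], hlc⟩, rfl⟩
  rw [← IsUnit.neg_iff] at hcu
  rwa [Algebra.algebraMap_eq_smul_one, show t • (1 : C) - a = -c by rw [hc]; abel]

/-- The spectrum of `a` is contained in `{0} ∪ {q²ⁿ}`. -/
lemma eq_zero_or_pow_of_mem_spectrum (h : PodlesRelations q a b) (hq : q ∈ Set.Ioo (0 : ℝ) 1)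
    {t : ℝ} (ht : t ∈ spectrum ℝ a) : t = 0 ∨ ∃ n : ℕ, t = q ^ (2 * n) := by
  by_contra! hcon
  obtain ⟨h0, hn⟩ := hcon
  have hq2 : 0 < q ^ 2 := pow_pos hq.1 2
  have hq1 : q ^ 2 < 1 := pow_lt_one₀ hq.1.le hq.2 two_ne_zero
  -- Dividing by `q ^ 2` stays in the spectrum unless the value `1` is reached, which would make `t`
  -- a power of `q ^ 2`. The quotients grow without bound, against boundedness of the spectrum.
  have hmem : ∀ n : ℕ, t / (q ^ 2) ^ n ∈ spectrum ℝ a := by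
    intro n
    induction n with
    | zero => simpa using ht
    | succ n ih =>
      rw [pow_succ, ← div_div]
      refine h.spectrum_step hq ih (by positivity) fun h1 => hn n ?_
      rw [div_eq_one_iff_eq (by positivity)] at h1
      rw [h1, pow_mul]
  obtain ⟨K, hK⟩ := (spectrum.isBounded (𝕜 := ℝ) a).exists_norm_le
  obtain ⟨n, hn'⟩ := pow_unbounded_of_one_lt (K / |t|) (one_lt_inv₀ hq2 |>.2 hq1)
  have h1 := hK _ (hmem n)
  rw [div_lt_iff₀ (abs_pos.2 h0)] at hn'
  rw [Real.norm_eq_abs, abs_div, abs_of_pos (pow_pos hq2 n), div_eq_mul_inv, ← inv_pow] at h1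
  linarith [mul_comm |t| ((q ^ 2)⁻¹ ^ n)]

/-- The spectral projection of `a` at `q²ⁿ`. -/
def proj (q : ℝ) (a : C) (n : ℕ) : C :=
  spectralProj a (q ^ (2 * n)) (q ^ (2 * n) * (1 - q ^ 2))

lemma gap_pos (hq : q ∈ Set.Ioo (0 : ℝ) 1) (n : ℕ) : 0 < q ^ (2 * n) * (1 - q ^ 2) :=
  mul_pos (pow_pos hq.1 _) (sub_pos.2 (pow_lt_one₀ hq.1.le hq.2 two_ne_zero))

/-- The nearest neighbour of `q ^ (2n)` is the next smaller point, `m = n + 1`, where equality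
holds. -/
lemma gap_pow (hq : q ∈ Set.Ioo (0 : ℝ) 1) {m n : ℕ} (hmn : m ≠ n) :
    q ^ (2 * n) * (1 - q ^ 2) ≤ |q ^ (2 * m) - q ^ (2 * n)| := by
  have hq2 : 0 < q ^ 2 := pow_pos hq.1 2
  have hq1 : q ^ 2 < 1 := pow_lt_one₀ hq.1.le hq.2 two_ne_zero
  have hn := pow_pos hq2 n
  simp only [pow_mul]
  generalize q ^ 2 = r at *
  rcases lt_or_gt_of_ne hmn with hlt | hlt
  · have h1 : r ^ n ≤ r ^ (m + 1) := pow_le_pow_of_le_one hq2.le hq1.le hlt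
    have h2 : r ^ (m + 1) ≤ r ^ m := pow_le_pow_of_le_one hq2.le hq1.le (by omega)
    rw [abs_of_nonneg (by linarith)]
    have h3 : r ^ n * (1 - r) ≤ r ^ m * (1 - r) :=
      mul_le_mul_of_nonneg_right (h1.trans h2) (sub_nonneg.2 hq1.le)
    rw [pow_succ] at h1
    linarith
  · have h1 : r ^ m ≤ r ^ (n + 1) := pow_le_pow_of_le_one hq2.le hq1.le hlt
    rw [pow_succ] at h1
    rw [abs_of_nonpos (by nlinarith)]
    linarith

lemma gap_spectrum (h : PodlesRelations q a b) (hq : q ∈ Set.Ioo (0 : ℝ) 1) (n : ℕ) :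
    ∀ t ∈ spectrum ℝ a, t ≠ q ^ (2 * n) → q ^ (2 * n) * (1 - q ^ 2) ≤ |t - q ^ (2 * n)| := by
  intro t ht hne
  have hq2 : 0 < q ^ 2 := pow_pos hq.1 2
  have hn : 0 < q ^ (2 * n) := pow_pos hq.1 _
  rcases h.eq_zero_or_pow_of_mem_spectrum hq ht with rfl | ⟨m, rfl⟩
  · rw [zero_sub, abs_neg, abs_of_pos hn]
    nlinarith
  · exact gap_pow hq fun hmn => hne (by rw [hmn])

lemma isSelfAdjoint_a (h : PodlesRelations q a b) : IsSelfAdjoint a := h.star_a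

lemma star_proj (n : ℕ) : star (proj q a n) = proj q a n := star_spectralProj

lemma a_mul_proj (h : PodlesRelations q a b) (hq : q ∈ Set.Ioo (0 : ℝ) 1) (n : ℕ) :
    a * proj q a n = q ^ (2 * n) • proj q a n :=
  mul_spectralProj h.isSelfAdjoint_a (gap_pos hq n) (h.gap_spectrum hq n)

lemma proj_mul_of_eq (h : PodlesRelations q a b) (hq : q ∈ Set.Ioo (0 : ℝ) 1) {n : ℕ} {y : C}
    (hy : a * y = q ^ (2 * n) • y) : proj q a n * y = y :=
  spectralProj_mul_of_eq h.isSelfAdjoint_a (gap_pos hq n) hy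

lemma proj_mul_proj (h : PodlesRelations q a b) (hq : q ∈ Set.Ioo (0 : ℝ) 1) (n : ℕ) :
    proj q a n * proj q a n = proj q a n := h.proj_mul_of_eq hq (h.a_mul_proj hq n)

/-- The scalar is zero at `n = 0` and positive for `n ≥ 1`: `b` kills the top projection and is
otherwise injective on the ladder. -/
lemma star_b_mul_b_mul_proj (h : PodlesRelations q a b) (hq : q ∈ Set.Ioo (0 : ℝ) 1) (n : ℕ) :
    star b * (b * proj q a n) = (q ^ (2 * n) * (1 - q ^ (2 * n))) • proj q a n := by
  rw [← mul_assoc, h.star_b_mul_b, sub_mul, pow_two, mul_assoc, h.a_mul_proj hq, mul_smul_comm,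
    h.a_mul_proj hq]
  module

lemma b_mul_proj_zero (h : PodlesRelations q a b) (hq : q ∈ Set.Ioo (0 : ℝ) 1) :
    b * proj q a 0 = 0 := by
  rw [← CStarRing.star_mul_self_eq_zero_iff, star_mul, mul_assoc, h.star_b_mul_b_mul_proj hq]
  simp

/-- By the commutation relation, `b` carries the eigenvalue `q ^ (2(n+1))` of `a` to `q ^ (2n)`. -/
lemma proj_mul_b_mul_proj (h : PodlesRelations q a b) (hq : q ∈ Set.Ioo (0 : ℝ) 1) (n : ℕ) :
    proj q a n * (b * proj q a (n + 1)) = b * proj q a (n + 1) := by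
  refine h.proj_mul_of_eq hq ?_
  have hq0 : q ≠ 0 := hq.1.ne'
  have h1 : (q ^ 2) • (a * (b * proj q a (n + 1))) = (q ^ 2 * q ^ (2 * n)) • (b * proj q a (n + 1)) := by
    rw [← mul_assoc, ← smul_mul_assoc, ← h.real_ba, mul_assoc, h.a_mul_proj hq, mul_smul_comm]
    congr 1
    ring
  rw [mul_smul] at h1
  exact smul_right_injective C (pow_ne_zero 2 hq0) h1

/-- Each `proj q a (n + 1)` lies in the ideal generated by `proj q a n`. -/
lemma proj_succ (h : PodlesRelations q a b) (hq : q ∈ Set.Ioo (0 : ℝ) 1) (n : ℕ) :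
    ∃ c : ℝ, proj q a (n + 1) = c • (star b * proj q a n * (b * proj q a (n + 1))) := by
  refine ⟨(q ^ (2 * (n + 1)) * (1 - q ^ (2 * (n + 1))))⁻¹, ?_⟩
  have h1 : q ^ (2 * (n + 1)) < 1 := pow_lt_one₀ hq.1.le hq.2 (by omega)
  have h2 : 0 < q ^ (2 * (n + 1)) := pow_pos hq.1 _
  rw [mul_assoc, h.proj_mul_b_mul_proj hq, h.star_b_mul_b_mul_proj hq, smul_smul,
    inv_mul_cancel₀ (mul_pos h2 (sub_pos.2 h1)).ne', one_smul]

lemma mul_proj_succ_eq_zero (h : PodlesRelations q a b) (hq : q ∈ Set.Ioo (0 : ℝ) 1) {n : ℕ} {w : C}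
    (hw : w * star b * proj q a n = 0) : w * proj q a (n + 1) = 0 := by
  obtain ⟨c, hc⟩ := h.proj_succ hq n
  rw [hc, mul_smul_comm, ← mul_assoc, ← mul_assoc w, hw, zero_mul, smul_zero]

lemma proj_zero_mul_of_eq (h : PodlesRelations q a b) (hq : q ∈ Set.Ioo (0 : ℝ) 1) {y : C}
    (hy : a * y = y) : proj q a 0 * y = y :=
  h.proj_mul_of_eq hq (by rw [hy, mul_zero, pow_zero, one_smul])

/-- On the spectrum each `bump` is the indicator of its own point, so the function left over
vanishes at `0` and at `q ^ (2m)` for `m < n`, and is `q ^ (2m) ≤ q ^ (2n)` for `m ≥ n`. -/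
lemma norm_a_sub_sum_le (h : PodlesRelations q a b) (hq : q ∈ Set.Ioo (0 : ℝ) 1) (n : ℕ) :
    ‖a - ∑ k ∈ Finset.range n, q ^ (2 * k) • proj q a k‖ ≤ q ^ (2 * n) := by
  have ha := h.isSelfAdjoint_a
  have hc (k : ℕ) := (continuous_bump (q ^ (2 * k)) (gap_pos hq k))
  have hcs : Continuous fun t => ∑ k ∈ Finset.range n,
      q ^ (2 * k) • bump (q ^ (2 * k)) (q ^ (2 * k) * (1 - q ^ 2)) t :=
    continuous_finsetSum _ fun k _ => by have := hc k; fun_prop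
  have h1 : a - ∑ k ∈ Finset.range n, q ^ (2 * k) • proj q a k
      = cfc (fun t => t - ∑ k ∈ Finset.range n,
        q ^ (2 * k) • bump (q ^ (2 * k)) (q ^ (2 * k) * (1 - q ^ 2)) t) a := by
    rw [cfc_sub (fun t : ℝ => t) _ a continuous_id.continuousOn hcs.continuousOn, cfc_id' ℝ a]
    congr 1
    rw [show (fun t => ∑ k ∈ Finset.range n,
        q ^ (2 * k) • bump (q ^ (2 * k)) (q ^ (2 * k) * (1 - q ^ 2)) t)
        = ∑ k ∈ Finset.range n, fun t =>
          q ^ (2 * k) • bump (q ^ (2 * k)) (q ^ (2 * k) * (1 - q ^ 2)) t by ext t; simp]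
    rw [cfc_sum (fun k t => q ^ (2 * k) • bump (q ^ (2 * k)) (q ^ (2 * k) * (1 - q ^ 2)) t) a _
      fun k _ => ((hc k).const_smul (q ^ (2 * k))).continuousOn]
    refine Finset.sum_congr rfl fun k _ => ?_
    rw [cfc_smul _ _ a (hc k).continuousOn]
    rfl
  rw [h1]
  refine norm_cfc_le (pow_nonneg hq.1.le _) fun t ht => ?_
  rcases h.eq_zero_or_pow_of_mem_spectrum hq ht with rfl | ⟨m, rfl⟩
  · rw [Finset.sum_eq_zero]
    · simpa using pow_nonneg hq.1.le (2 * n)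
    · intro k _
      rw [bump_eq_zero (gap_pos hq k), smul_zero]
      rw [zero_sub, abs_neg, abs_of_pos (pow_pos hq.1 _)]
      nlinarith [pow_pos hq.1 (2 * k), pow_pos hq.1 2]
  · have h2 (k : ℕ) : q ^ (2 * k) • bump (q ^ (2 * k)) (q ^ (2 * k) * (1 - q ^ 2)) (q ^ (2 * m))
        = if k = m then q ^ (2 * m) else 0 := by
      split_ifs with hkm
      · subst hkm
        simp [bump_self]
      · rw [bump_eq_zero (gap_pos hq k) (gap_pow hq (Ne.symm hkm)), smul_zero]
    simp only [h2, Finset.sum_ite_eq', Finset.mem_range]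
    split_ifs with hmn
    · simpa using pow_nonneg hq.1.le (2 * n)
    · rw [sub_zero, Real.norm_of_nonneg (pow_nonneg hq.1.le _)]
      exact pow_le_pow_of_le_one hq.1.le hq.2.le (by omega)

lemma mul_a_eq_zero (h : PodlesRelations q a b) (hq : q ∈ Set.Ioo (0 : ℝ) 1) {x : C}
    (hx : ∀ n, x * proj q a n = 0) : x * a = 0 := by
  have h1 (n : ℕ) : ‖x * a‖ ≤ ‖x‖ * (q ^ 2) ^ n := by
    have : x * a = x * (a - ∑ k ∈ Finset.range n, q ^ (2 * k) • proj q a k) := by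
      rw [mul_sub, Finset.mul_sum, Finset.sum_eq_zero fun k _ => by rw [mul_smul_comm, hx, smul_zero],
        sub_zero]
    rw [this]
    refine (norm_mul_le _ _).trans (mul_le_mul_of_nonneg_left ?_ (norm_nonneg _))
    rw [← pow_mul]
    exact h.norm_a_sub_sum_le hq n
  have h2 : Tendsto (fun n : ℕ => ‖x‖ * (q ^ 2) ^ n) atTop (𝓝 (‖x‖ * 0)) :=
    (tendsto_pow_atTop_nhds_zero_of_lt_one (sq_nonneg q)
      (pow_lt_one₀ hq.1.le hq.2 two_ne_zero)).const_mul _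
  rw [mul_zero] at h2
  exact norm_le_zero_iff.1 (ge_of_tendsto' h2 h1)

end PodlesRelations

end

end QuantumSphere

namespace QuantumSphere

noncomputable section

/-! ## The universal property -/

namespace PodlesRelations

variable {q : ℝ} {C : Type*} [CStarAlgebra C] {a b : C}

lemma a_mul_star_b_pow_mul_proj (h : PodlesRelations q a b) (hq : q ∈ Set.Ioo (0 : ℝ) 1) (k : ℕ) :
    a * (star b ^ k * proj q a 0) = (q ^ 2) ^ k • (star b ^ k * proj q a 0) := by
  induction k with
  | zero => simpa using h.a_mul_proj hq 0
  | succ k ih =>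
    rw [pow_succ', mul_assoc, ← mul_assoc a, h.a_mul_star_b, smul_mul_assoc, mul_assoc, ih,
      mul_smul_comm, smul_smul, ← pow_succ']

/-- The span of the vectors `(b*)ᵏ p₀`. -/
def orbitSpan (q : ℝ) (a b : C) : Submodule ℂ C :=
  Submodule.span ℂ (Set.range fun k : ℕ => star b ^ k * proj q a 0)

lemma star_b_pow_mul_proj_mem (k : ℕ) : star b ^ k * proj q a 0 ∈ orbitSpan q a b :=
  Submodule.subset_span ⟨k, rfl⟩

lemma mul_mem_orbitSpan_of {g : C}
    (hg : ∀ k : ℕ, g * (star b ^ k * proj q a 0) ∈ orbitSpan q a b) {y : C}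
    (hy : y ∈ orbitSpan q a b) : g * y ∈ orbitSpan q a b := by
  have : orbitSpan q a b ≤ (orbitSpan q a b).comap (LinearMap.mulLeft ℂ g) := by
    refine Submodule.span_le.2 ?_
    rintro _ ⟨k, rfl⟩
    exact hg k
  exact this hy

lemma a_mul_mem_orbitSpan (h : PodlesRelations q a b) (hq : q ∈ Set.Ioo (0 : ℝ) 1) {y : C}
    (hy : y ∈ orbitSpan q a b) : a * y ∈ orbitSpan q a b := by
  refine mul_mem_orbitSpan_of (fun k => ?_) hy
  rw [h.a_mul_star_b_pow_mul_proj hq, ← Complex.coe_smul]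
  exact Submodule.smul_mem _ _ (star_b_pow_mul_proj_mem k)

/-- `b` kills `p_0`, and in every other spanning vector it meets a `b*`, where `b b*` is a
polynomial in `a`. -/
lemma b_mul_mem_orbitSpan (h : PodlesRelations q a b) (hq : q ∈ Set.Ioo (0 : ℝ) 1) {y : C}
    (hy : y ∈ orbitSpan q a b) : b * y ∈ orbitSpan q a b := by
  refine mul_mem_orbitSpan_of (fun k => ?_) hy
  cases k with
  | zero => simp [h.b_mul_proj_zero hq]
  | succ k =>
    have hk := star_b_pow_mul_proj_mem (q := q) (a := a) (b := b) k
    rw [pow_succ', mul_assoc, ← mul_assoc, h.b_mul_star_b, sub_mul, smul_mul_assoc, smul_mul_assoc,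
      pow_two a, mul_assoc]
    exact Submodule.sub_mem _ (Submodule.smul_mem _ _ (h.a_mul_mem_orbitSpan hq hk))
      (Submodule.smul_mem _ _ (h.a_mul_mem_orbitSpan hq (h.a_mul_mem_orbitSpan hq hk)))

lemma star_b_mul_mem_orbitSpan {y : C} (hy : y ∈ orbitSpan q a b) :
    star b * y ∈ orbitSpan q a b := by
  refine mul_mem_orbitSpan_of (fun k => ?_) hy
  rw [← mul_assoc, ← pow_succ']
  exact star_b_pow_mul_proj_mem (k + 1)

/-- Induction on the `*`-algebra generated by `a` and `b`. -/
lemma adjoin_induction (h : PodlesRelations q a b) {p : C → Prop} (ha : p a) (hb : p b)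
    (hsb : p (star b)) (hr : ∀ r : ℂ, p (algebraMap ℂ C r)) (hadd : ∀ x y, p x → p y → p (x + y))
    (hmul : ∀ x y, p x → p y → p (x * y)) {x : C} (hx : x ∈ StarAlgebra.adjoin ℂ {a, b}) : p x := by
  have hx' : x ∈ Algebra.adjoin ℂ ({a, b} ∪ star {a, b}) := hx
  refine Algebra.adjoin_induction (fun y hy => ?_) hr (fun x y _ _ => hadd x y)
    (fun x y _ _ => hmul x y) hx'
  rcases hy with (rfl | rfl) | hy
  · exact ha
  · exact hb
  · rcases hy with hy | hy
    · rw [star_eq_iff_star_eq, h.star_a] at hy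
      exact hy ▸ ha
    · rw [Set.mem_singleton_iff, star_eq_iff_star_eq] at hy
      exact hy ▸ hsb

lemma mul_mem_orbitSpan (h : PodlesRelations q a b) (hq : q ∈ Set.Ioo (0 : ℝ) 1) {z : C}
    (hz : z ∈ StarAlgebra.adjoin ℂ {a, b}) : ∀ y ∈ orbitSpan q a b, z * y ∈ orbitSpan q a b := by
  refine h.adjoin_induction (p := fun z => ∀ y ∈ orbitSpan q a b, z * y ∈ orbitSpan q a b)
    (fun y => h.a_mul_mem_orbitSpan hq) (fun y => h.b_mul_mem_orbitSpan hq)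
    (fun y => star_b_mul_mem_orbitSpan) (fun r y hy => ?_) (fun x y hx hy w hw => ?_)
    (fun x y hx hy w hw => ?_) hz
  · rw [← Algebra.smul_def]
    exact Submodule.smul_mem _ _ hy
  · rw [add_mul]
    exact Submodule.add_mem _ (hx w hw) (hy w hw)
  · rw [mul_assoc]
    exact hx _ (hy w hw)

/-- Since `p_0 b* = (b p_0)* = 0`, only the spanning vector with `k = 0` survives. -/
lemma proj_mul_mem_span (h : PodlesRelations q a b) (hq : q ∈ Set.Ioo (0 : ℝ) 1) {y : C}
    (hy : y ∈ orbitSpan q a b) : proj q a 0 * y ∈ Submodule.span ℂ {proj q a 0} := by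
  have : orbitSpan q a b ≤
      (Submodule.span ℂ {proj q a 0}).comap (LinearMap.mulLeft ℂ (proj q a 0)) := by
    refine Submodule.span_le.2 ?_
    rintro _ ⟨k, rfl⟩
    change proj q a 0 * (star b ^ k * proj q a 0) ∈ Submodule.span ℂ {proj q a 0}
    cases k with
    | zero =>
      rw [pow_zero, one_mul, h.proj_mul_proj hq]
      exact Submodule.mem_span_singleton_self _
    | succ k =>
      have h0 : proj q a 0 * star b = 0 := by
        have := congrArg star (h.b_mul_proj_zero hq)
        rwa [star_mul, star_proj, star_zero] at this
      rw [pow_succ', mul_assoc, ← mul_assoc, h0, zero_mul]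
      exact Submodule.zero_mem _
  exact this hy

/-- The corner `p₀ C*(a, b) p₀` is spanned by `p₀`. -/
lemma proj_mul_mul_proj (h : PodlesRelations q a b) (hq : q ∈ Set.Ioo (0 : ℝ) 1) {z : C}
    (hz : z ∈ (StarAlgebra.adjoin ℂ {a, b}).topologicalClosure) :
    ∃ c : ℂ, proj q a 0 * z * proj q a 0 = c • proj q a 0 := by
  -- A line is finite-dimensional, hence closed, so the statement passes from the generated
  -- `*`-algebra to its closure.
  have hcl : IsClosed {z : C | proj q a 0 * z * proj q a 0 ∈ Submodule.span ℂ {proj q a 0}} :=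
    (Submodule.closed_of_finiteDimensional (Submodule.span ℂ {proj q a 0})).preimage
      (f := fun z => proj q a 0 * z * proj q a 0) (by fun_prop)
  have hsub : ((StarAlgebra.adjoin ℂ {a, b} : StarSubalgebra ℂ C) : Set C) ⊆
      {z : C | proj q a 0 * z * proj q a 0 ∈ Submodule.span ℂ {proj q a 0}} := by
    intro z hz
    change proj q a 0 * z * proj q a 0 ∈ Submodule.span ℂ {proj q a 0}
    rw [mul_assoc]
    refine h.proj_mul_mem_span hq (h.mul_mem_orbitSpan hq hz _ ?_)
    simpa using star_b_pow_mul_proj_mem (q := q) (a := a) (b := b) 0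
  obtain ⟨c, hc⟩ := Submodule.mem_span_singleton.1 (closure_minimal hsub hcl hz)
  exact ⟨c, hc.symm⟩

end PodlesRelations

/-! ### The lift, constructed from its graph -/

section Lift

variable {q : ℝ} {D : Type*} [CStarAlgebra D] {a b : D}

lemma podlesRelations_prod (hq : q ∈ Set.Ioo (0 : ℝ) 1) (h : PodlesRelations q a b) :
    PodlesRelations q ((opA q, a) : Op × D) (opB q, b) where
  star_a := Prod.ext (podlesRelations_op hq).star_a h.star_a
  ba := Prod.ext (podlesRelations_op hq).ba h.ba
  star_b_mul_b := Prod.ext (podlesRelations_op hq).star_b_mul_b h.star_b_mul_b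
  b_mul_star_b := Prod.ext (podlesRelations_op hq).b_mul_star_b h.b_mul_star_b

/-- The closed `*`-subalgebra generated by `(A, a)` and `(B, b)`: the graph of the
`*`-homomorphism that sends `A` to `a` and `B` to `b`. -/
def podlesGraph (q : ℝ) (a b : D) : StarSubalgebra ℂ (Op × D) :=
  (StarAlgebra.adjoin ℂ {(opA q, a), (opB q, b)}).topologicalClosure

lemma opA_mem_podlesGraph : (opA q, a) ∈ podlesGraph q a b :=
  StarSubalgebra.le_topologicalClosure _ (StarAlgebra.subset_adjoin ℂ _ (by simp))

lemma opB_mem_podlesGraph : (opB q, b) ∈ podlesGraph q a b :=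
  StarSubalgebra.le_topologicalClosure _ (StarAlgebra.subset_adjoin ℂ _ (by simp))

instance isClosed_podlesGraph : IsClosed (podlesGraph q a b : Set (Op × D)) :=
  StarSubalgebra.isClosed_topologicalClosure _

lemma mul_proj_zero_of_fst_eq_zero (hq : q ∈ Set.Ioo (0 : ℝ) 1) (h : PodlesRelations q a b)
    {w : Op × D} (hw : w ∈ podlesGraph q a b) (hw0 : w.1 = 0) :
    w * PodlesRelations.proj q (opA q, a) 0 = 0 := by
  have hR := podlesRelations_prod hq h
  obtain ⟨c, hc⟩ := hR.proj_mul_mul_proj hq (mul_mem (star_mem hw) hw)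
  have hE : opA q * E 0 0 = E 0 0 := by
    ext1 x
    simp [mul_apply_eq_comp, E_apply, opA_e hq]
  -- The first coordinate of `p_0` need not be computed: `(E 0 0, 0)` is fixed by `(A, a)`, so `p_0`
  -- fixes it. Comparing first coordinates then turns the corner identity into `0 = c • E 0 0`.
  have hp : PodlesRelations.proj q ((opA q, a) : Op × D) 0 * (E 0 0, 0) = (E 0 0, 0) :=
    hR.proj_zero_mul_of_eq hq (Prod.ext hE (mul_zero a))
  have hp1 := congrArg Prod.fst hp
  have hc1 := congrArg (fun z : Op × D => z.1 * E 0 0) hc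
  simp only [Prod.fst_mul, Prod.smul_fst, smul_mul_assoc, hw0, mul_zero, zero_mul] at hc1 hp1
  rw [hp1] at hc1
  have hc0 : c = 0 := by
    have := congrArg norm hc1
    rw [norm_smul, norm_E] at this
    simpa using this.symm
  rw [← CStarRing.star_mul_self_eq_zero_iff, star_mul, PodlesRelations.star_proj]
  rw [hc0, zero_smul] at hc
  rw [← hc]
  simp only [mul_assoc]

/-- The quantifier over `w` stays inside the induction because the step replaces `w` by `w b*`,
which lies in the graph and again has first coordinate `0`. -/
lemma mul_proj_of_fst_eq_zero (hq : q ∈ Set.Ioo (0 : ℝ) 1) (h : PodlesRelations q a b) (n : ℕ) :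
    ∀ w ∈ podlesGraph q a b, w.1 = 0 → w * PodlesRelations.proj q (opA q, a) n = 0 := by
  induction n with
  | zero => exact fun w hw hw0 => mul_proj_zero_of_fst_eq_zero hq h hw hw0
  | succ n ih =>
    intro w hw hw0
    exact (podlesRelations_prod hq h).mul_proj_succ_eq_zero hq
      (ih (w * star (opB q, b)) (mul_mem hw (star_mem opB_mem_podlesGraph))
        (by rw [Prod.fst_mul, hw0, zero_mul]))

lemma norm_counit_le (z : PodlesC) : ‖counit z‖ ≤ ‖z‖ := NonUnitalStarAlgHom.norm_apply_le counit z

lemma counit_ofCompact (k : Op) (hk : IsCompactOperator k) : counit (ofCompact k hk) = 0 :=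
  counit_eq hk (by simp [ofCompact])

lemma counit_genA (q : ℝ) : counit (genA q) = 0 := counit_ofCompact _ _

lemma counit_genB (q : ℝ) : counit (genB q) = 0 := counit_ofCompact _ _

lemma eq_zero_of_fst_eq_zero (hq : q ∈ Set.Ioo (0 : ℝ) 1) (h : PodlesRelations q a b)
    {x : Op × D} (hx : x ∈ podlesGraph q a b) (hx0 : x.1 = 0) : x = 0 := by
  have hR := podlesRelations_prod hq h
  have hxa : x * (opA q, a) = 0 :=
    hR.mul_a_eq_zero hq fun n => mul_proj_of_fst_eq_zero hq h n x hx hx0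
  -- By the C*-identity it suffices that `x b b* x* = 0`, and `b b*` has a left factor `a`.
  have hxb : x * (opB q, b) = 0 := by
    rw [← CStarRing.mul_star_self_eq_zero_iff, star_mul, mul_assoc, ← mul_assoc (opB q, b),
      hR.b_mul_star_b, ← mul_assoc, mul_sub, pow_two (opA q, a), mul_smul_comm, mul_smul_comm,
      ← mul_assoc x (opA q, a), hxa]
    simp
  have hxsb : x * star (opB q, b) = 0 := by
    rw [← CStarRing.mul_star_self_eq_zero_iff, star_mul, star_star, mul_assoc,
      ← mul_assoc (star (opB q, b)), hR.star_b_mul_b, ← mul_assoc, mul_sub, pow_two, ← mul_assoc x (opA q, a), hxa]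
    simp
  -- As `x` annihilates the generators, right multiplication by `y` acts on `x` through the
  -- character of 𝒦 ⊕ ℂ, evaluated at the first coordinate of `y`.
  have hgen : ∀ y ∈ StarAlgebra.adjoin ℂ {((opA q, a) : Op × D), (opB q, b)},
      ∃ z : PodlesC, (z : Op) = y.1 ∧ x * y = counit z • x := by
    intro y hy
    refine hR.adjoin_induction (p := fun y => ∃ z : PodlesC, (z : Op) = y.1 ∧ x * y = counit z • x)
      ?_ ?_ ?_ ?_ ?_ ?_ hy
    · refine ⟨genA q, rfl, ?_⟩
      rw [hxa, counit_genA, zero_smul]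
    · refine ⟨genB q, rfl, ?_⟩
      rw [hxb, counit_genB, zero_smul]
    · refine ⟨star (genB q), rfl, ?_⟩
      rw [hxsb, map_star, counit_genB, star_zero, zero_smul]
    · intro r
      refine ⟨algebraMap ℂ PodlesC r, rfl, ?_⟩
      rw [AlgHomClass.commutes, ← Algebra.commutes, ← Algebra.smul_def, Algebra.algebraMap_self_apply]
    · rintro y y' ⟨z, hz, hxy⟩ ⟨z', hz', hxy'⟩
      refine ⟨z + z', by simp [hz, hz'], ?_⟩
      rw [mul_add, hxy, hxy', map_add, add_smul]
    · rintro y y' ⟨z, hz, hxy⟩ ⟨z', hz', hxy'⟩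
      refine ⟨z * z', by simp [hz, hz'], ?_⟩
      rw [← mul_assoc, hxy, smul_mul_assoc, hxy', map_mul, smul_smul]
  -- The norm estimate, unlike the witness `z`, passes directly to limits. At `y = star x`, whose
  -- first coordinate is `0`, it yields `x * star x = 0`.
  have hcl : IsClosed {y : Op × D | ‖x * y‖ ≤ ‖y.1‖ * ‖x‖} :=
    isClosed_le (by fun_prop) (by fun_prop)
  have hle : ‖x * star x‖ ≤ ‖(star x).1‖ * ‖x‖ := by
    refine closure_minimal (fun y hy => ?_) hcl (star_mem hx : star x ∈ podlesGraph q a b)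
    obtain ⟨z, hz, hxy⟩ := hgen y hy
    rw [Set.mem_ofPred_eq, hxy, norm_smul, ← hz]
    exact mul_le_mul_of_nonneg_right (norm_counit_le z) (norm_nonneg _)
  rw [Prod.fst_star, hx0, star_zero, norm_zero, zero_mul, norm_le_zero_iff] at hle
  exact (CStarRing.mul_star_self_eq_zero_iff x).1 hle

/-- The first projection of the graph. -/
def podlesGraphFst (q : ℝ) (a b : D) : podlesGraph q a b →⋆ₐ[ℂ] Op :=
  (StarAlgHom.fst ℂ Op D).comp (podlesGraph q a b).subtype

lemma podlesGraphFst_injective (hq : q ∈ Set.Ioo (0 : ℝ) 1) (h : PodlesRelations q a b) :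
    Function.Injective (podlesGraphFst q a b) := by
  rw [injective_iff_map_eq_zero]
  rintro ⟨x, hx⟩ h0
  exact Subtype.ext (eq_zero_of_fst_eq_zero hq h hx h0)

/-- An injective `*`-homomorphism of C*-algebras is isometric, so its range is closed; it contains
`A` and `B`. -/
lemma podlesC_le_range (hq : q ∈ Set.Ioo (0 : ℝ) 1) (h : PodlesRelations q a b) :
    PodlesC ≤ (podlesGraphFst q a b).range :=
  podlesC_le_of_mem hq
    (NonUnitalStarAlgHom.isometry (podlesGraphFst q a b)
      (podlesGraphFst_injective hq h)).isClosedEmbedding.isClosed_range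
    ⟨⟨_, opA_mem_podlesGraph⟩, rfl⟩ ⟨⟨_, opB_mem_podlesGraph⟩, rfl⟩

/-- The `*`-homomorphism `C(S_q²) → D` determined by a solution of the relations in `D`. -/
def podlesLift (hq : q ∈ Set.Ioo (0 : ℝ) 1) (h : PodlesRelations q a b) : PodlesC →⋆ₐ[ℂ] D :=
  ((StarAlgHom.snd ℂ Op D).comp (podlesGraph q a b).subtype).comp
    (((StarAlgEquiv.ofInjective (podlesGraphFst q a b) (podlesGraphFst_injective hq h)).symm :
      _ →⋆ₐ[ℂ] podlesGraph q a b).comp (StarSubalgebra.inclusion (podlesC_le_range hq h)))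

lemma podlesLift_eq (hq : q ∈ Set.Ioo (0 : ℝ) 1) (h : PodlesRelations q a b) {x : PodlesC} {d : D}
    (hx : ((x : Op), d) ∈ podlesGraph q a b) : podlesLift hq h x = d := by
  have : (StarAlgEquiv.ofInjective (podlesGraphFst q a b) (podlesGraphFst_injective hq h)).symm
      (StarSubalgebra.inclusion (podlesC_le_range hq h) x) = ⟨((x : Op), d), hx⟩ := by
    rw [StarAlgEquiv.symm_apply_eq]
    rfl
  change ((StarAlgEquiv.ofInjective (podlesGraphFst q a b) (podlesGraphFst_injective hq h)).symm
      (StarSubalgebra.inclusion (podlesC_le_range hq h) x)).1.2 = d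
  rw [this]

lemma continuous_podlesHom (φ : PodlesC →⋆ₐ[ℂ] D) : Continuous φ :=
  AddMonoidHomClass.continuous_of_bound φ 1 fun x => by
    rw [one_mul]
    exact NonUnitalStarAlgHom.norm_apply_le φ x

lemma podlesHom_ext (hq : q ∈ Set.Ioo (0 : ℝ) 1) {φ ψ : PodlesC →⋆ₐ[ℂ] D}
    (hA : φ (genA q) = ψ (genA q)) (hB : φ (genB q) = ψ (genB q)) : φ = ψ := by
  have hcl : IsClosed (((StarAlgHom.equalizer φ ψ).map PodlesC.subtype : StarSubalgebra ℂ Op) :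
      Set Op) := by
    rw [StarSubalgebra.coe_map]
    exact isClosed_podlesC.isClosedEmbedding_subtypeVal.isClosedMap _
      (isClosed_eq (continuous_podlesHom φ) (continuous_podlesHom ψ))
  have hle := podlesC_le_of_mem hq hcl ⟨genA q, hA, rfl⟩ ⟨genB q, hB, rfl⟩
  ext x
  obtain ⟨y, hy, hyx⟩ := hle x.2
  have : y = x := Subtype.ext hyx
  exact this ▸ hy

end Lift

/-- `𝒦(ℓ²(ℕ)) ⊕ ℂ` is the universal `C*`-algebra of the standard Podleś sphere. -/
lemma isUniversalPodles {q : ℝ} (hq : q ∈ Set.Ioo (0 : ℝ) 1) :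
    IsUniversalPodles.{u} q (genA q) (genB q) where
  relations := podlesRelations_gen hq
  existsUnique_lift D _ a b h := by
    refine ⟨podlesLift hq h, ⟨podlesLift_eq hq h opA_mem_podlesGraph,
      podlesLift_eq hq h opB_mem_podlesGraph⟩, fun ψ hψ => podlesHom_ext hq ?_ ?_⟩
    · rw [hψ.1]
      exact (podlesLift_eq hq h opA_mem_podlesGraph).symm
    · rw [hψ.2]
      exact (podlesLift_eq hq h opB_mem_podlesGraph).symm

end

end QuantumSphere

namespace QuantumSphere

noncomputable section

/-! ## The kernel of the symbol map -/

lemma star_S_mul_S : star S * S = 1 := by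
  ext x n
  simp [mul_apply_eq_comp, star_S_apply, S_apply_succ]

lemma S_mul_star_S : S * star S = 1 - E 0 0 := by rw [← one_sub_S_star]; abel

lemma E_mul_S : E 0 0 * S = 0 := by
  rw [← one_sub_S_star, sub_mul, one_mul, mul_assoc, star_S_mul_S, mul_one, sub_self]

lemma star_S_mul_E : star S * E 0 0 = 0 := by
  have := congrArg star E_mul_S
  rwa [star_mul, star_E, star_zero] at this

/-- The Halmos dilation of the shift, a unitary in the `2 × 2` matrices over the bounded
operators. -/
def dilation : CStarMatrix (Fin 2) (Fin 2) Op := CStarMatrix.ofMatrix !![S, E 0 0; 0, star S]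

/-- The entry `E 0 0 = 1 - S S*` is the defect that makes up for `S` not being unitary. -/
lemma dilation_mem_unitary : dilation ∈ unitary (CStarMatrix (Fin 2) (Fin 2) Op) := by
  have hE : E 0 0 * E 0 0 = E 0 0 := E_mul_E 0 0 0
  rw [Unitary.mem_iff]
  constructor <;> ext i j : 2 <;> rw [CStarMatrix.mul_apply, Fin.sum_univ_two] <;>
    fin_cases i <;> fin_cases j <;>
    simp [dilation, CStarMatrix.star_apply, star_S_mul_S, S_mul_star_S,
      E_mul_S, star_S_mul_E, star_E, hE]

instance isStarNormal_dilation : IsStarNormal dilation :=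
  isStarNormal_of_mem_unitary dilation_mem_unitary

/-- The inclusion of the spectrum of the dilation into the circle. -/
def dilationSpectrum : C(spectrum ℂ dilation, Circle) where
  toFun z := ⟨z, spectrum.subset_circle_of_unitary dilation_mem_unitary z.2⟩
  continuous_toFun := by
    exact continuous_subtype_val.subtype_mk _

/-- The continuous functional calculus of the dilation, on functions on the circle. -/
def dilationCalculus : C(Circle, ℂ) →⋆ₐ[ℂ] CStarMatrix (Fin 2) (Fin 2) Op :=
  (cfcHom (R := ℂ) isStarNormal_dilation).comp (ContinuousMap.compStarAlgHom' ℂ ℂ dilationSpectrum)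

lemma dilationCalculus_uPow : dilationCalculus (uPow 1) = dilation := by
  refine Eq.trans ?_ (cfcHom_id (R := ℂ) isStarNormal_dilation)
  change cfcHom (R := ℂ) isStarNormal_dilation _ = _
  congr 1
  ext z
  change (((dilationSpectrum z) ^ (1 : ℤ) : Circle) : ℂ) = z
  rw [zpow_one]
  rfl

/-- The Toeplitz operator with continuous symbol `f`, the corner of `f` of the dilation. -/
def toeplitzOp : C(Circle, ℂ) →ₗ[ℂ] Op where
  toFun f := dilationCalculus f 0 0
  map_add' f g := by rw [map_add, CStarMatrix.add_apply]
  map_smul' c f := by rw [map_smul, CStarMatrix.smul_apply, RingHom.id_apply]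

lemma continuous_toeplitzOp : Continuous toeplitzOp :=
  AddMonoidHomClass.continuous_of_bound toeplitzOp 1 fun f => by
    rw [one_mul]
    exact (CStarMatrix.norm_entry_le_norm (M := dilationCalculus f) (i := 0) (j := 0)).trans
      (NonUnitalStarAlgHom.norm_apply_le dilationCalculus f)

lemma toeplitzOp_one : toeplitzOp 1 = 1 := by
  change dilationCalculus 1 0 0 = 1
  rw [map_one, CStarMatrix.one_apply_eq]

/-- Exact, with no compact error, because the lower left entry of the dilation is zero. -/
lemma toeplitzOp_mul_uPow (f : C(Circle, ℂ)) : toeplitzOp (f * uPow 1) = toeplitzOp f * S := by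
  change dilationCalculus (f * uPow 1) 0 0 = dilationCalculus f 0 0 * S
  rw [map_mul, dilationCalculus_uPow, CStarMatrix.mul_apply, Fin.sum_univ_two]
  simp [dilation]

lemma star_uPow_mul_uPow : star (uPow 1) * uPow 1 = 1 := by
  ext z
  simp [uPow, ← Complex.normSq_eq_conj_mul_self]

/-- Multiply the identity `T_f = T_{fū} S` on the right by `S*`; the defect of `S S*` leaves a
finite-rank error. -/
lemma toeplitzOp_mul_star_uPow (f : C(Circle, ℂ)) :
    toeplitzOp (f * star (uPow 1)) =
      toeplitzOp f * star S + toeplitzOp (f * star (uPow 1)) * E 0 0 := by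
  have h := toeplitzOp_mul_uPow (f * star (uPow 1))
  rw [mul_assoc, star_uPow_mul_uPow, mul_one] at h
  rw [h, mul_assoc, S_mul_star_S, mul_sub, mul_one, sub_add_cancel]

/-- `t` is a compact perturbation of the Toeplitz operator with the same symbol. -/
def IsToeplitzModCompact (t : Toeplitz) : Prop :=
  (t : Op) - toeplitzOp (symbol t) ∈ compactOperator (RingHom.id ℂ) Ell2 Ell2

lemma IsToeplitzModCompact.mul_shiftT {t : Toeplitz} (ht : IsToeplitzModCompact t) :
    IsToeplitzModCompact (t * shiftT) := by
  have h : ((t * shiftT : Toeplitz) : Op) - toeplitzOp (symbol (t * shiftT)) =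
      ((t : Op) - toeplitzOp (symbol t)) * S := by
    rw [map_mul, symbol_shiftT, toeplitzOp_mul_uPow, sub_mul]
    rfl
  rw [IsToeplitzModCompact, h]
  exact IsCompactOperator.comp_clm ht S

lemma IsToeplitzModCompact.mul_star_shiftT {t : Toeplitz} (ht : IsToeplitzModCompact t) :
    IsToeplitzModCompact (t * star shiftT) := by
  have h : ((t * star shiftT : Toeplitz) : Op) - toeplitzOp (symbol (t * star shiftT)) =
      ((t : Op) - toeplitzOp (symbol t)) * star S -
        toeplitzOp (symbol t * star (uPow 1)) * E 0 0 := by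
    rw [map_mul, map_star, symbol_shiftT, sub_mul, sub_sub, ← toeplitzOp_mul_star_uPow]
    rfl
  rw [IsToeplitzModCompact, h]
  exact Submodule.sub_mem _ (IsCompactOperator.comp_clm ht (star S))
    ((isCompactOperator_E 0 0).clm_comp (toeplitzOp (symbol t * star (uPow 1))))

lemma IsToeplitzModCompact.add {t s : Toeplitz} (ht : IsToeplitzModCompact t)
    (hs : IsToeplitzModCompact s) : IsToeplitzModCompact (t + s) := by
  have h : ((t + s : Toeplitz) : Op) - toeplitzOp (symbol (t + s)) =
      ((t : Op) - toeplitzOp (symbol t)) + ((s : Op) - toeplitzOp (symbol s)) := by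
    rw [map_add, map_add, ← add_sub_add_comm]
    rfl
  rw [IsToeplitzModCompact, h]
  exact Submodule.add_mem _ ht hs

lemma IsToeplitzModCompact.smul {t : Toeplitz} (ht : IsToeplitzModCompact t) (c : ℂ) :
    IsToeplitzModCompact (c • t) := by
  have h : ((c • t : Toeplitz) : Op) - toeplitzOp (symbol (c • t)) =
      c • ((t : Op) - toeplitzOp (symbol t)) := by
    rw [map_smul, map_smul, smul_sub]
    rfl
  rw [IsToeplitzModCompact, h]
  exact Submodule.smul_mem _ c ht

lemma isToeplitzModCompact_one : IsToeplitzModCompact 1 := by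
  have h : ((1 : Toeplitz) : Op) - toeplitzOp (symbol 1) = 0 := by
    rw [map_one, toeplitzOp_one]
    exact sub_self _
  rw [IsToeplitzModCompact, h]
  exact Submodule.zero_mem _

lemma isClosed_isToeplitzModCompact : IsClosed {t : Toeplitz | IsToeplitzModCompact t} := by
  have hc : Continuous fun t : Toeplitz => (t : Op) - toeplitzOp (symbol t) :=
    continuous_subtype_val.sub (continuous_toeplitzOp.comp (continuous_starAlgHom symbol))
  exact (isClosed_setOfPred_isCompactOperator (σ₁₂ := RingHom.id ℂ) (M₁ := Ell2)
    (M₂ := Ell2)).preimage hc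

lemma isToeplitzModCompact (t : Toeplitz) : IsToeplitzModCompact t := by
  have hsub : ((StarAlgebra.adjoin ℂ {S} : StarSubalgebra ℂ Op) : Set Op) ⊆
      Subtype.val '' {t : Toeplitz | IsToeplitzModCompact t} := by
    intro x hx
    have hx' : x ∈ Algebra.adjoin ℂ ({S} ∪ star {S}) := hx
    -- `f ↦ T_f` is not multiplicative, so the induction runs over those `s` for which right
    -- multiplication by `s` preserves the property. These are visibly closed under products, and
    -- applying `s` to `1` gives the claim.
    obtain ⟨s, rfl, hs⟩ : ∃ s : Toeplitz, (s : Op) = x ∧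
        ∀ t, IsToeplitzModCompact t → IsToeplitzModCompact (t * s) := by
      refine Algebra.adjoin_induction (p := fun x _ => ∃ s : Toeplitz, (s : Op) = x ∧
        ∀ t, IsToeplitzModCompact t → IsToeplitzModCompact (t * s)) ?_ ?_ ?_ ?_ hx'
      · rintro y (rfl | hy)
        · exact ⟨shiftT, rfl, fun t => IsToeplitzModCompact.mul_shiftT⟩
        · rw [Set.mem_star, Set.mem_singleton_iff, star_eq_iff_star_eq] at hy
          exact ⟨star shiftT, hy, fun t => IsToeplitzModCompact.mul_star_shiftT⟩
      · intro r
        refine ⟨algebraMap ℂ Toeplitz r, rfl, fun t ht => ?_⟩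
        rw [← Algebra.commutes, ← Algebra.smul_def]
        exact ht.smul r
      · rintro _ _ _ _ ⟨s, rfl, hs⟩ ⟨s', rfl, hs'⟩
        refine ⟨s + s', rfl, fun t ht => ?_⟩
        rw [mul_add]
        exact (hs t ht).add (hs' t ht)
      · rintro _ _ _ _ ⟨s, rfl, hs⟩ ⟨s', rfl, hs'⟩
        refine ⟨s * s', rfl, fun t ht => ?_⟩
        rw [← mul_assoc]
        exact hs' _ (hs t ht)
    exact ⟨s, by simpa using hs 1 isToeplitzModCompact_one, rfl⟩
  have hcl : IsClosed (Subtype.val '' {t : Toeplitz | IsToeplitzModCompact t}) :=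
    isClosed_toeplitz.isClosedEmbedding_subtypeVal.isClosedMap _ isClosed_isToeplitzModCompact
  obtain ⟨s, hs, hst⟩ := closure_minimal hsub hcl t.2
  have : s = t := Subtype.ext hst
  exact this ▸ hs

/-- The kernel of the symbol map consists of compact operators. -/
lemma isCompactOperator_of_symbol_eq_zero {t : Toeplitz} (ht : symbol t = 0) :
    IsCompactOperator (t : Op) := by
  have h := isToeplitzModCompact t
  rw [IsToeplitzModCompact, ht, map_zero, sub_zero] at h
  exact h

end

end QuantumSphere

namespace QuantumSphere

noncomputable section

/-! ## The isomorphisms of modules -/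

lemma mem_podlesC_of_symbol {t : Toeplitz} {α : ℂ} (h : symbol t = algebraMap ℂ C(Circle, ℂ) α) :
    (t : Op) ∈ PodlesC := by
  refine ⟨(t - algebraMap ℂ Toeplitz α : Toeplitz), α,
    isCompactOperator_of_symbol_eq_zero ?_, ?_⟩
  · rw [map_sub, AlgHomClass.commutes, h, sub_self]
  · exact (sub_add_cancel (t : Op) (algebraMap ℂ Op α)).symm

/-- An element of the Toeplitz algebra with constant symbol, as an element of `𝒦 ⊕ ℂ`. -/
def ofConstSymbol (t : Toeplitz) (h : ∃ α, symbol t = algebraMap ℂ C(Circle, ℂ) α) : PodlesC :=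
  ⟨t, h.elim fun _ => mem_podlesC_of_symbol⟩

lemma toToeplitz_ofConstSymbol (t : Toeplitz) (h) : toToeplitz (ofConstSymbol t h) = t := rfl

lemma toToeplitz_injective : Function.Injective toToeplitz := fun _ _ h =>
  Subtype.ext (congrArg (fun t : Toeplitz => (t : Op)) h)

lemma counit_ofConstSymbol {t : Toeplitz} {α : ℂ} (h : symbol t = algebraMap ℂ C(Circle, ℂ) α) :
    counit (ofConstSymbol t ⟨α, h⟩) = α := by
  change symbol t 1 = α
  rw [h]
  simp

lemma uPow_natCast (N : ℕ) : uPow N = uPow 1 ^ N := by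
  ext z
  simp [uPow]

lemma uPow_neg (k : ℤ) : uPow (-k) = star (uPow k) := by
  ext z
  change ((z ^ (-k) : Circle) : ℂ) = (starRingEnd ℂ) ((z ^ k : Circle) : ℂ)
  rw [zpow_neg, Circle.coe_inv_eq_conj]

lemma uPow_mul_star (k : ℤ) : uPow k * star (uPow k) = 1 := by
  rw [← uPow_neg]
  ext z
  change ((z ^ k : Circle) : ℂ) * ((z ^ (-k) : Circle) : ℂ) = 1
  rw [← Circle.coe_mul, zpow_neg, mul_inv_cancel, Circle.coe_one]

lemma symbol_shiftT_pow (N : ℕ) : symbol (shiftT ^ N) = uPow N := by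
  rw [map_pow, symbol_shiftT, uPow_natCast]

lemma symbol_star_shiftT_pow (N : ℕ) : symbol (star (shiftT ^ N)) = uPow (-N) := by
  rw [map_star, symbol_shiftT_pow, uPow_neg]

lemma star_shiftT_pow_mul (N : ℕ) : star (shiftT ^ N) * shiftT ^ N = 1 := by
  induction N with
  | zero => simp
  | succ N ih =>
    have h : star shiftT * shiftT = 1 := Subtype.ext star_S_mul_S
    rw [pow_succ', star_mul, mul_assoc, ← mul_assoc (star shiftT), h, one_mul, ih]

lemma toToeplitz_projNeg (N : ℕ) : toToeplitz (projNeg N) = shiftT ^ N * star (shiftT ^ N) := rfl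

lemma counit_projNeg (N : ℕ) : counit (projNeg N) = 1 := by
  change symbol (toToeplitz (projNeg N)) 1 = 1
  rw [toToeplitz_projNeg, map_mul, map_star, symbol_shiftT_pow, uPow_mul_star]
  rfl

lemma symbol_mul_shiftT_pow {N : ℕ} (p : FibreProduct (N : ℤ)) :
    symbol (p.1.1 * shiftT ^ N) = algebraMap ℂ C(Circle, ℂ) p.1.2 := by
  rw [map_mul, symbol_shiftT_pow, mul_comm]
  exact p.2

lemma symbol_mul_star_shiftT_pow {N : ℕ} (p : FibreProduct (-(N : ℤ))) :
    symbol (p.1.1 * star (shiftT ^ N)) = algebraMap ℂ C(Circle, ℂ) p.1.2 := by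
  rw [map_mul, symbol_star_shiftT_pow, mul_comm]
  exact p.2

/-- For the idempotent `p_{-N}`, the left ideal it generates is its fixed space under right
multiplication. -/
lemma mem_span_projNeg {N : ℕ} {x : PodlesC} :
    x ∈ Submodule.span PodlesC {projNeg N} ↔ x * projNeg N = x := by
  have hp : projNeg N * projNeg N = projNeg N := by
    apply toToeplitz_injective
    rw [map_mul, toToeplitz_projNeg, mul_assoc, ← mul_assoc (star _), star_shiftT_pow_mul, one_mul]
  rw [Submodule.mem_span_singleton]
  constructor
  · rintro ⟨y, rfl⟩
    rw [smul_eq_mul, mul_assoc, hp]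
  · exact fun h => ⟨x, h⟩

/-- The isomorphism `𝒯 ×_{(u⁻ᴺσ, 1)} ℂ ≅ C(S_q²) p_{-N}`, `(h, β) ↦ h (Sᴺ)*`. -/
def fibreProductNegEquiv (N : ℕ) :
    FibreProduct (-(N : ℤ)) ≃ₗ[PodlesC] Submodule.span PodlesC {projNeg N} where
  toFun p := ⟨ofConstSymbol (p.1.1 * star (shiftT ^ N)) ⟨_, symbol_mul_star_shiftT_pow p⟩, by
    refine mem_span_projNeg.2 (toToeplitz_injective ?_)
    rw [map_mul, toToeplitz_ofConstSymbol, toToeplitz_projNeg, mul_assoc, ← mul_assoc (star _),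
      star_shiftT_pow_mul, one_mul]⟩
  map_add' p p' := Subtype.ext (toToeplitz_injective
    (add_mul p.1.1 p'.1.1 (star (shiftT ^ N))))
  map_smul' x p := Subtype.ext (toToeplitz_injective
    (mul_assoc (toToeplitz x) p.1.1 (star (shiftT ^ N))))
  invFun x := ⟨(toToeplitz x.1 * shiftT ^ N, counit x.1), by
    change uPow (-N) * symbol (toToeplitz x.1 * shiftT ^ N) = algebraMap ℂ C(Circle, ℂ) (counit x.1)
    rw [map_mul, symbol_shiftT_pow, symbol_eq_counit, mul_left_comm, uPow_neg, mul_comm (star _),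
      uPow_mul_star, mul_one]⟩
  left_inv p := by
    refine Subtype.ext (Prod.ext ?_ (counit_ofConstSymbol (symbol_mul_star_shiftT_pow p)))
    change p.1.1 * star (shiftT ^ N) * shiftT ^ N = p.1.1
    rw [mul_assoc, star_shiftT_pow_mul, mul_one]
  right_inv x := by
    refine Subtype.ext (toToeplitz_injective ?_)
    change toToeplitz x.1 * shiftT ^ N * star (shiftT ^ N) = toToeplitz x.1
    rw [mul_assoc, ← toToeplitz_projNeg, ← map_mul, mem_span_projNeg.1 x.2]

lemma vecMul_projPos (N : ℕ) (v : Fin 2 → PodlesC) :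
    Matrix.vecMul v (projPos N) = ![v 0, v 1 * (1 - projNeg N)] := by
  ext i : 1
  fin_cases i <;> simp [projPos, Matrix.vecMul, dotProduct, Fin.sum_univ_two]

/-- The first coordinate is free; the second lies in the range of the idempotent complementary to
`p_{-N}`. -/
lemma mem_rowModule_projPos {N : ℕ} {v : Fin 2 → PodlesC} :
    v ∈ rowModule (projPos N) ↔ v 1 * projNeg N = 0 := by
  have hp : projNeg N * projNeg N = projNeg N :=
    mem_span_projNeg.1 (Submodule.mem_span_singleton_self _)
  constructor
  · rintro ⟨w, rfl⟩
    rw [Matrix.vecMulLinear_apply, vecMul_projPos]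
    change w 1 * (1 - projNeg N) * projNeg N = 0
    rw [mul_assoc, sub_mul, one_mul, hp, sub_self, mul_zero]
  · intro h
    refine ⟨v, ?_⟩
    rw [Matrix.vecMulLinear_apply, vecMul_projPos, mul_sub, mul_one, h, sub_zero]
    ext i : 1
    fin_cases i <;> rfl

/-- Any Toeplitz `t` is allowed here, since `1 - S ^ N (S ^ N)*` already has symbol `0`. So the
second coordinate of the isomorphism lies in 𝒦 ⊕ ℂ. -/
lemma symbol_mul_one_sub_projNeg (t : Toeplitz) (N : ℕ) :
    symbol (t * (1 - toToeplitz (projNeg N))) = algebraMap ℂ C(Circle, ℂ) 0 := by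
  rw [map_mul, map_sub, map_one, symbol_eq_counit, counit_projNeg, map_one, sub_self, mul_zero,
    map_zero]

lemma toToeplitz_mul_shiftT_pow_eq_zero {N : ℕ} {x : PodlesC} (hx : x * projNeg N = 0) :
    toToeplitz x * shiftT ^ N = 0 := by
  have h := congrArg (fun y => toToeplitz y * shiftT ^ N) hx
  simp only [map_mul, toToeplitz_projNeg, map_zero, zero_mul] at h
  rwa [mul_assoc, mul_assoc (shiftT ^ N), star_shiftT_pow_mul, mul_one] at h

/-- The isomorphism `𝒯 ×_{(uᴺσ, 1)} ℂ ≅ C(S_q²)² p_N`, `(h, β) ↦ (h Sᴺ, h (1 - Sᴺ (Sᴺ)*))`. -/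
def fibreProductEquiv (N : ℕ) : FibreProduct (N : ℤ) ≃ₗ[PodlesC] rowModule (projPos N) where
  toFun p := ⟨![ofConstSymbol (p.1.1 * shiftT ^ N) ⟨_, symbol_mul_shiftT_pow p⟩,
      ofConstSymbol (p.1.1 * (1 - toToeplitz (projNeg N))) ⟨_, symbol_mul_one_sub_projNeg _ N⟩], by
    refine mem_rowModule_projPos.2 (toToeplitz_injective ?_)
    change p.1.1 * (1 - toToeplitz (projNeg N)) * toToeplitz (projNeg N) = 0
    rw [mul_assoc, sub_mul, one_mul, ← map_mul,
      mem_span_projNeg.1 (Submodule.mem_span_singleton_self _), sub_self, mul_zero]⟩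
  map_add' p p' := by
    refine Subtype.ext (funext fun i => toToeplitz_injective ?_)
    fin_cases i
    · exact add_mul p.1.1 p'.1.1 (shiftT ^ N)
    · exact add_mul p.1.1 p'.1.1 (1 - toToeplitz (projNeg N))
  map_smul' x p := by
    refine Subtype.ext (funext fun i => toToeplitz_injective ?_)
    fin_cases i
    · exact mul_assoc (toToeplitz x) p.1.1 (shiftT ^ N)
    · exact mul_assoc (toToeplitz x) p.1.1 (1 - toToeplitz (projNeg N))
  invFun v := ⟨(toToeplitz (v.1 0) * star (shiftT ^ N) + toToeplitz (v.1 1), counit (v.1 0)), by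
    -- `v 1` is annihilated by `p_{-N}`, whose character value is `1`; hence only `v 0` contributes
    -- to the symbol.
    have h1 : counit (v.1 1) = 0 := by
      have := congrArg counit (mem_rowModule_projPos.1 v.2)
      rwa [map_mul, counit_projNeg, mul_one, map_zero] at this
    change uPow N * symbol (toToeplitz (v.1 0) * star (shiftT ^ N) + toToeplitz (v.1 1)) =
      algebraMap ℂ C(Circle, ℂ) (counit (v.1 0))
    rw [map_add, map_mul, symbol_star_shiftT_pow, symbol_eq_counit, symbol_eq_counit, h1, map_zero,
      add_zero, mul_left_comm, uPow_neg, uPow_mul_star, mul_one]⟩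
  left_inv p := by
    refine Subtype.ext (Prod.ext ?_ (counit_ofConstSymbol (symbol_mul_shiftT_pow p)))
    change p.1.1 * shiftT ^ N * star (shiftT ^ N) + p.1.1 * (1 - toToeplitz (projNeg N)) = p.1.1
    rw [mul_assoc, ← toToeplitz_projNeg, ← mul_add, add_sub_cancel, mul_one]
  right_inv v := by
    -- With `v 1 * S ^ N = 0`, the two summands of the inverse separate: multiplying by `S ^ N`
    -- recovers `v 0`, and multiplying by `1 - S ^ N (S ^ N)*` recovers `v 1`.
    have h1 := toToeplitz_mul_shiftT_pow_eq_zero (mem_rowModule_projPos.1 v.2)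
    refine Subtype.ext (funext fun i => toToeplitz_injective ?_)
    fin_cases i
    · change (toToeplitz (v.1 0) * star (shiftT ^ N) + toToeplitz (v.1 1)) * shiftT ^ N
        = toToeplitz (v.1 0)
      rw [add_mul, h1, mul_assoc, star_shiftT_pow_mul, mul_one, add_zero]
    · change (toToeplitz (v.1 0) * star (shiftT ^ N) + toToeplitz (v.1 1)) *
        (1 - toToeplitz (projNeg N)) = toToeplitz (v.1 1)
      rw [toToeplitz_projNeg, mul_sub, mul_one, ← mul_assoc, add_mul, h1, mul_assoc (toToeplitz _),
        star_shiftT_pow_mul, mul_one, add_zero, add_sub_cancel_left]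

end

end QuantumSphere

theorem proposition3p4 (q : ℝ) (hq : q ∈ Set.Ioo (0 : ℝ) 1) :
    QuantumSphere.IsUniversalPodles.{u} q (QuantumSphere.genA q) (QuantumSphere.genB q) ∧
    ∀ N : ℕ,
      Nonempty (QuantumSphere.FibreProduct (N : ℤ) ≃ₗ[QuantumSphere.PodlesC]
        QuantumSphere.rowModule (QuantumSphere.projPos N)) ∧
      Nonempty (QuantumSphere.FibreProduct (-(N : ℤ)) ≃ₗ[QuantumSphere.PodlesC]
        Submodule.span QuantumSphere.PodlesC {QuantumSphere.projNeg N}) :=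
  ⟨QuantumSphere.isUniversalPodles hq, fun N =>
    ⟨⟨QuantumSphere.fibreProductEquiv N⟩, ⟨QuantumSphere.fibreProductNegEquiv N⟩⟩⟩
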